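/- Let $\mathcal K$ be a real Hilbert space. Let $A\colon\mathcal K\to 2^{\mathcal K}$ be maximally monotone, let $\beta>0$, and let $B\colon\mathcal K\to\mathcal K$ be $\beta$-cocoercive, that is, $\langle x-y, Bx-By\rangle\ge\beta\|Bx-By\|^2$ for all $x,y\in\mathcal K$. Assume that the set $\mathcal P=\{x\in\mathcal K : 0\in Ax+Bx\}$ is nonempty. Let $U\colon\mathcal K\to\mathcal K$ be a bounded linear operator that is self-adjoint and strongly positive (there is $\chi>0$ with $\langle Ux,x\rangle\ge\chi\|x\|^2$ for all $x$). Let $\varepsilon\in\left]0,\min\{1,\beta\|U\|^{-1}\}\right[$, let $(\gamma_n)_{n\in\mathbb N}$ be a sequence in $[\varepsilon,(2-\varepsilon)\beta\|U\|^{-1}]$ and $(\alpha_n)_{n\in\mathbb N}$ a sequence in $[0,1-\varepsilon]$ (both deterministic; if $\mathcal K=\{0\}$ we read $\|U\|^{-1}=+\infty$). On a probability space, let $(r_n)_{n\in\mathbb N}$ be a sequence of square integrable $\mathcal K$-valued random variables, let $w_0$ be a square integrable $\mathcal K$-valued random variable (random variables being strongly measurable if $\mathcal K$ is not separable), set $w_{-1}=w_0$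 and, for every $n\in\mathbb N$, $$z_n=w_n+\alpha_n(w_n-w_{n-1}),\qquad w_{n+1}=J_{\gamma_nUA}(z_n-\gamma_nUr_n),$$ where $J_T=(\mathrm{Id}+T)^{-1}$ denotes the resolvent of $T$. Let $\mathcal F_n=\sigma(w_0,\dots,w_n)$ and suppose that 1. $\mathsf E[r_n\mid\mathcal F_n]=Bw_n$ a.s. for every $n\in\mathbb N$; 2. $\sum_{n\in\mathbb N}\mathsf E[\|r_n-Bw_n\|^2\mid\mathcal F_n]<+\infty$ a.s.; 3. $\sup_{n\in\mathbb N}\|w_n-w_{n-1}\|<+\infty$ a.s., and $\sum_{n\in\mathbb N}\alpha_n<+\infty$. Then there is a $\mathcal K$-valued random variable $\overline w$, with $\overline w\in\mathcal P$ a.s., such that (i) $w_n\rightharpoonup\overline w$ weakly a.s.; (ii) $Bw_n\to B\overline w$ in norm a.s.; (iii) for almost every $\omega$, if $B$ is uniformly monotone at $\overline w(\omega)$, then $\|w_n(\omega)-\overline w(\omega)\|\to0$. In particular, if $B$ is a.s. uniformly monotone at $\overline w$, then $w_n\to\overline w$ in norm a.s. Here $B$ is uniformly monotone at $x$ if there is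 a nondecreasing function $\phi\colon[0,+\infty[\to[0,+\infty]$ vanishing only at $0$ such that $\langle x-y,Bx-By\rangle\ge\phi(\|x-y\|)$ for all $y\in\mathcal K$. -/

import Mathlib

open MeasureTheory ProbabilityTheory Filter Topology
open scoped NNReal ENNReal RealInnerProductSpace

namespace StochFB

section Operators

variable {K : Type*} [NormedAddCommGroup K] [InnerProductSpace ℝ K]

/-- A set-valued operator `A : K → 2^K` is monotone if `⟪v₁ - v₂, z₁ - z₂⟫ ≥ 0` for all
`v₁ ∈ A z₁`, `v₂ ∈ A z₂`. -/
def IsMonotoneOp (A : K → Set K) : Prop :=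
  ∀ z₁ z₂ : K, ∀ v₁ ∈ A z₁, ∀ v₂ ∈ A z₂, 0 ≤ ⟪v₁ - v₂, z₁ - z₂⟫

/-- Maximal monotonicity: `A` is monotone and no monotone operator has a graph properly
containing the graph of `A`. The order on `K → Set K` is pointwise inclusion, that is, inclusion
of graphs. -/
def IsMaximallyMonotone (A : K → Set K) : Prop :=
  Maximal IsMonotoneOp A

/-- `B : K → K` is `β`-cocoercive. -/
def IsCocoercive (β : ℝ) (B : K → K) : Prop :=
  ∀ z₁ z₂ : K, β * ‖B z₁ - B z₂‖ ^ 2 ≤ ⟪z₁ - z₂, B z₁ - B z₂⟫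

/-- `B : K → K` is uniformly monotone at the point `x`: there is an increasing (in the sense of
nondecreasing) function `φ : [0, ∞) → [0, ∞]` that vanishes only at `0`, with
`⟪x - y, B x - B y⟫ ≥ φ ‖x - y‖` for all `y`. -/
def IsUniformlyMonotoneAt (B : K → K) (x : K) : Prop :=
  ∃ φ : ℝ≥0 → ℝ≥0∞, Monotone φ ∧ (∀ t, φ t = 0 ↔ t = 0) ∧
    ∀ y : K, (φ ‖x - y‖₊ : EReal) ≤ ((⟪x - y, B x - B y⟫ : ℝ) : EReal)

/-- A bounded linear operator `U` is strongly positive if `⟪U x, x⟫ ≥ χ ‖x‖ ^ 2` for some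
`χ > 0`. -/
def IsStronglyPositive (U : K →L[ℝ] K) : Prop :=
  ∃ χ : ℝ, 0 < χ ∧ ∀ x : K, χ * ‖x‖ ^ 2 ≤ ⟪U x, x⟫

/-- The set-valued operator `γ U A : x ↦ {γ U a | a ∈ A x}`. -/
def precond (γ : ℝ) (U : K →L[ℝ] K) (A : K → Set K) : K → Set K :=
  fun x => (fun a => γ • U a) '' A x

/-- The resolvent `J_T = (Id + T)⁻¹` of a set-valued operator `T`, as the inverse of a set-valued
operator: `y ∈ J_T x` if and only if `x ∈ y + T y`. When `T = γ U A` with `A` maximally monotone,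
`U` self-adjoint strongly positive and `γ > 0`, the set `J_T x` is a singleton for every `x`, so
that `y ∈ J_T x` says `y = J_T x`. -/
def resolvent (T : K → Set K) : K → Set K :=
  fun x => {y | ∃ a ∈ T y, x = y + a}

/-- The set of solutions of the inclusion `0 ∈ A x + B x`. -/
def zeros (A : K → Set K) (B : K → K) : Set K :=
  {x | ∃ a ∈ A x, a + B x = 0}

end Operators

/-- The σ-algebra `σ(w 0, …, w n)` generated by the first `n + 1` members of a process. -/
abbrev history {Ω K : Type*} [MeasurableSpace K] (w : ℕ → Ω → K) (n : ℕ) : MeasurableSpace Ω :=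
  ⨆ i ≤ n, MeasurableSpace.comap (w i) inferInstance

/-- The extrapolated point `z n = w n + α n (w n - w (n - 1))`. For `n = 0` the natural number
`n - 1` is `0`, which is the convention `w (-1) = w 0`, so that `z 0 = w 0`. -/
def extrapolate {Ω K : Type*} [NormedAddCommGroup K] [InnerProductSpace ℝ K]
    (α : ℕ → ℝ) (w : ℕ → Ω → K) (n : ℕ) : Ω → K :=
  fun ω => w n ω + α n • (w n ω - w (n - 1) ω)

end StochFB

/-! Distances are measured by the quadratic form `⟪V x, x⟫` with `V = U⁻¹`. For it `γ U A` is
monotone, and the cross term of a forward step is an ordinary inner product, so cocoercivity of `B`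
applies unchanged. For a fixed zero `x`, `IsMetricInverse.step_le` gives a quasi-Fejér inequality:
the new squared distance to `x` plus a residual is at most `1 + α n` times the old one, plus
inertial and noise terms, minus an inner product of the noise with a vector known at time `n`.
Conditioning removes that inner product, the other perturbations are summable, and
`robbins_siegmund` yields a.s. convergence of the distances and summability of the residuals.

The rest is pathwise. Vanishing residuals give `B (w n) → B x` and elements of `A (w (n + 1))`
tending to `-B x`, so every weak cluster point is a zero, and an Opial argument leaves only one.
Since the exceptional null set depends on `x`, only countably many `x` may be used: a countable
dense set of zeros in the closed span of the values of `w`, which is separable even if `K` is not.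
`exists_weakTendsto_of_opial` therefore asks only that cluster points lie in `closure D`. The limit
is measurable as a limit of finite-rank projections. -/

namespace StochFB

/-! ### Convergence of almost supermartingales. -/

section Probability

variable {Ω : Type*} {m0 : MeasurableSpace Ω} {μ : Measure Ω}

/-- The partial sums of a nonnegative sequence, stopped before they exceed `C`, are at most `C`. -/
lemma sum_ite_sum_le {ρ : ℕ → ℝ} (hρ : ∀ n, 0 ≤ ρ n) {C : ℝ} (hC : 0 ≤ C) (n : ℕ) :
    ∑ k ∈ Finset.range n, (if ∑ i ∈ Finset.range (k + 1), ρ i ≤ C then ρ k else 0) ≤ C := by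
  induction n with
  | zero => simpa using hC
  | succ n ih =>
    by_cases h : ∑ i ∈ Finset.range (n + 1), ρ i ≤ C
    · refine le_trans (Finset.sum_le_sum fun k _ => ?_) h
      split_ifs
      · exact le_rfl
      · exact hρ k
    · rw [Finset.sum_range_succ, if_neg h, add_zero]
      exact ih

lemma exists_nat_forall_sum_le {ρ : ℕ → ℝ} (hρ : ∀ n, 0 ≤ ρ n) (h : Summable ρ) :
    ∃ C : ℕ, ∀ n, ∑ i ∈ Finset.range n, ρ i ≤ C := by
  obtain ⟨C, hC⟩ := exists_nat_ge (∑' n, ρ n)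
  exact ⟨C, fun n => (h.sum_le_tsum _ fun i _ => hρ i).trans hC⟩

/-- Nonnegative random variables with a.s. summable conditional expectations are a.s. summable. -/
theorem ae_summable_of_ae_summable_condExp [IsFiniteMeasure μ] (ℱ : Filtration ℕ m0)
    {T : ℕ → Ω → ℝ} (hT : ∀ n ω, 0 ≤ T n ω) (hint : ∀ n, Integrable (T n) μ)
    (hsum : ∀ᵐ ω ∂μ, Summable fun n => (μ[T n | ℱ n]) ω) :
    ∀ᵐ ω ∂μ, Summable fun n => T n ω := by
  set θ : ℕ → Ω → ℝ := fun n => μ[T n | ℱ n] with hθ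
  have hθ0 : ∀ᵐ ω ∂μ, ∀ n, 0 ≤ θ n ω := ae_all_iff.2 fun n =>
    condExp_nonneg (Eventually.of_forall (hT n))
  -- `θ n` is known at time `n`, so the truncation may include index `n` and still be `ℱ
  -- n`-measurable; hence `T n` and `θ n` have equal integrals over `s C n`.
  let s : ℕ → ℕ → Set Ω := fun C n => {ω | ∑ i ∈ Finset.range (n + 1), θ i ω ≤ C}
  have hs : ∀ C n, MeasurableSet[ℱ n] (s C n) := fun C n => by
    refine StronglyMeasurable.measurableSet_le (m := ℱ n) ?_ stronglyMeasurable_const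
    refine Finset.stronglyMeasurable_fun_sum _ fun i hi => ?_
    exact stronglyMeasurable_condExp.mono (ℱ.mono (by simp at hi; omega))
  have hs0 : ∀ C n, MeasurableSet (s C n) := fun C n => ℱ.le n _ (hs C n)
  have key : ∀ C : ℕ, ∀ᵐ ω ∂μ,
      ∑' n, (s C n).indicator (fun ω => ENNReal.ofReal (T n ω)) ω < ∞ := fun C => by
    have hm : ∀ n, AEMeasurable ((s C n).indicator (fun ω => ENNReal.ofReal (T n ω))) μ := fun n =>
      (hint n).aemeasurable.ennreal_ofReal.indicator (hs0 C n)
    have hm' : ∀ n, AEMeasurable ((s C n).indicator (fun ω => ENNReal.ofReal (θ n ω))) μ := fun n =>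
      integrable_condExp.aemeasurable.ennreal_ofReal.indicator (hs0 C n)
    refine ae_lt_top' (AEMeasurable.tsum hm) (ne_of_lt ?_)
    have e : ∀ n, ∫⁻ ω, (s C n).indicator (fun ω => ENNReal.ofReal (T n ω)) ω ∂μ
        = ∫⁻ ω, (s C n).indicator (fun ω => ENNReal.ofReal (θ n ω)) ω ∂μ := fun n => by
      rw [lintegral_indicator (hs0 C n), lintegral_indicator (hs0 C n),
        ← ofReal_integral_eq_lintegral_ofReal (hint n).integrableOn
          (Eventually.of_forall (hT n)),
        ← ofReal_integral_eq_lintegral_ofReal (integrable_condExp (m := ℱ n)).integrableOn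
          (ae_restrict_of_ae (hθ0.mono fun ω h => h n)),
        setIntegral_condExp (ℱ.le n) (hint n) (hs C n)]
    rw [lintegral_tsum hm]
    simp_rw [e]
    rw [← lintegral_tsum hm']
    calc _ ≤ ∫⁻ _, (C : ℝ≥0∞) ∂μ := by
          refine lintegral_mono_ae ?_
          filter_upwards [hθ0] with ω hω
          refine ENNReal.tsum_le_of_sum_range_le fun n => ?_
          have := sum_ite_sum_le hω (Nat.cast_nonneg C) n
          calc _ = ENNReal.ofReal (∑ k ∈ Finset.range n,
                (if ∑ i ∈ Finset.range (k + 1), θ i ω ≤ C then θ k ω else 0)) := by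
                rw [ENNReal.ofReal_sum_of_nonneg]
                · refine Finset.sum_congr rfl fun k _ => ?_
                  simp only [Set.indicator, s, Set.mem_ofPred_eq]
                  split_ifs <;> simp
                · intro i _
                  split_ifs
                  exacts [hω i, le_rfl]
            _ ≤ _ := by
              rw [← ENNReal.ofReal_natCast]
              exact ENNReal.ofReal_le_ofReal this
      _ < ∞ := by
        rw [lintegral_const]
        exact ENNReal.mul_lt_top (by simp) (measure_lt_top _ _)
  filter_upwards [hsum, hθ0, ae_all_iff.2 key] with ω h1 h2 h3
  obtain ⟨C, hC⟩ := exists_nat_forall_sum_le h2 h1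
  have h4 : ∑' n, ENNReal.ofReal (T n ω) ≠ ∞ := by
    refine (lt_of_eq_of_lt ?_ (h3 C)).ne
    refine tsum_congr fun n => ?_
    rw [Set.indicator_of_mem]
    exact hC (n + 1)
  have := ENNReal.summable_toReal h4
  refine this.congr fun n => ?_
  rw [ENNReal.toReal_ofReal (hT n ω)]

/-- A supermartingale which is bounded below converges almost surely. -/
theorem Supermartingale.exists_ae_tendsto_of_le [IsFiniteMeasure μ] {ℱ : Filtration ℕ m0}
    {f : ℕ → Ω → ℝ} (hf : Supermartingale f ℱ μ) {C : ℝ} (hC : 0 ≤ C)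
    (hb : ∀ n, ∀ᵐ ω ∂μ, -C ≤ f n ω) :
    ∀ᵐ ω ∂μ, ∃ c, Tendsto (fun n => f n ω) atTop (𝓝 c) := by
  have hmean : ∀ n, ∫ ω, f n ω ∂μ ≤ ∫ ω, f 0 ω ∂μ := fun n => by
    simpa using hf.setIntegral_le (Nat.zero_le n) MeasurableSet.univ
  -- From `-C ≤ f n` one gets `|f n| ≤ f n + 2 C`, and the means of a supermartingale do not
  -- increase: an L¹ bound uniform in `n`.
  have hnorm : ∀ n, eLpNorm (f n) 1 μ
      ≤ ((∫ ω, f 0 ω ∂μ + ∫ _, 2 * C ∂μ).toNNReal : ℝ≥0) := fun n => by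
    rw [eLpNorm_one_eq_lintegral_enorm, ← ofReal_integral_norm_eq_lintegral_enorm (hf.integrable n)]
    refine ENNReal.ofReal_le_ofReal ?_
    have : ∫ ω, ‖f n ω‖ ∂μ ≤ ∫ ω, (f n ω + 2 * C) ∂μ := by
      refine integral_mono_ae (hf.integrable n).norm
        ((hf.integrable n).add (integrable_const _)) ?_
      filter_upwards [hb n] with ω hω
      rw [Real.norm_eq_abs, abs_le]
      constructor <;> linarith
    rw [integral_add (hf.integrable n) (integrable_const _)] at this
    linarith [hmean n]
  have := hf.neg.exists_ae_tendsto_of_bdd (R := (∫ ω, f 0 ω ∂μ + ∫ _, 2 * C ∂μ).toNNReal)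
    (fun n => by rw [Pi.neg_apply, eLpNorm_neg]; exact hnorm n)
  filter_upwards [this] with ω ⟨c, hc⟩
  exact ⟨-c, by simpa using hc.neg⟩

/-- The Robbins–Siegmund theorem without multiplicative perturbations. -/
theorem robbins_siegmund_additive [IsFiniteMeasure μ] (ℱ : Filtration ℕ m0)
    {X T R : ℕ → Ω → ℝ} (hX : ∀ n ω, 0 ≤ X n ω) (hT : ∀ n ω, 0 ≤ T n ω) (hR : ∀ n ω, 0 ≤ R n ω)
    (hXm : StronglyAdapted ℱ X)
    (hXi : ∀ n, Integrable (X n) μ) (hTi : ∀ n, Integrable (T n) μ)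
    (hle : ∀ n, μ[X (n + 1) | ℱ n] + μ[T n | ℱ n] ≤ᵐ[μ] X n + μ[R n | ℱ n])
    (hsum : ∀ᵐ ω ∂μ, Summable fun n => (μ[R n | ℱ n]) ω) :
    ∀ᵐ ω ∂μ, (∃ c, Tendsto (fun n => X n ω) atTop (𝓝 c)) ∧ Summable fun n => T n ω := by
  set θ : ℕ → Ω → ℝ := fun n => μ[T n | ℱ n] with hθ
  set ρ : ℕ → Ω → ℝ := fun n => μ[R n | ℱ n] with hρ
  have hθ0 : ∀ᵐ ω ∂μ, ∀ n, 0 ≤ θ n ω := ae_all_iff.2 fun n =>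
    condExp_nonneg (Eventually.of_forall (hT n))
  have hρ0 : ∀ᵐ ω ∂μ, ∀ n, 0 ≤ ρ n ω := ae_all_iff.2 fun n =>
    condExp_nonneg (Eventually.of_forall (hR n))
  have hθm : ∀ n, StronglyMeasurable[ℱ n] (θ n) := fun n => stronglyMeasurable_condExp
  have hρm : ∀ n, StronglyMeasurable[ℱ n] (ρ n) := fun n => stronglyMeasurable_condExp
  set S : ℕ → Ω → ℝ := fun n => X n + ∑ k ∈ Finset.range n, (θ k - ρ k) with hS
  have hSm : StronglyAdapted ℱ S := fun n => by
    refine (hXm n).add (Finset.stronglyMeasurable_sum _ fun k hk => ?_)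
    have : k ≤ n := by simp at hk; omega
    exact ((hθm k).sub (hρm k)).mono (ℱ.mono this)
  have hSi : ∀ n, Integrable (S n) μ := fun n =>
    (hXi n).add (integrable_finsetSum' _ fun k _ => integrable_condExp.sub integrable_condExp)
  have hSsuper : Supermartingale S ℱ μ := by
    refine supermartingale_of_condExp_sub_nonneg_nat hSm hSi fun n => ?_
    have e : S n - S (n + 1) = (X n - θ n + ρ n) - X (n + 1) := by
      simp only [hS, Finset.sum_range_succ]
      abel
    have hm : StronglyMeasurable[ℱ n] (X n - θ n + ρ n) := ((hXm n).sub (hθm n)).add (hρm n)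
    have hi : Integrable (X n - θ n + ρ n) μ :=
      ((hXi n).sub integrable_condExp).add integrable_condExp
    rw [e]
    have h1 := condExp_sub hi (hXi (n + 1)) (ℱ n)
    rw [condExp_of_stronglyMeasurable (ℱ.le n) hm hi] at h1
    filter_upwards [h1, hle n] with ω h1 h2
    rw [h1]
    simp only [Pi.add_apply, Pi.sub_apply, Pi.zero_apply] at h2 ⊢
    linarith
  have key : ∀ C : ℕ, ∀ᵐ ω ∂μ, (∀ n, ∑ i ∈ Finset.range n, ρ i ω ≤ C) →
      ∃ c, Tendsto (fun n => S n ω) atTop (𝓝 c) := fun C => by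
    -- `S` need not be bounded below, as the sums of `ρ` may be large. Keeping only its increments
    -- on these events amounts to stopping it before those sums exceed `C`.
    let s : ℕ → Set Ω := fun n => {ω | ∑ i ∈ Finset.range (n + 1), ρ i ω ≤ C}
    have hs : ∀ n, MeasurableSet[ℱ n] (s n) := fun n => by
      refine StronglyMeasurable.measurableSet_le (m := ℱ n) ?_ stronglyMeasurable_const
      refine Finset.stronglyMeasurable_fun_sum _ fun i hi => ?_
      exact (hρm i).mono (ℱ.mono (by simp at hi; omega))
    set χ : ℕ → Ω → ℝ := fun n => (s n).indicator 1 with hχ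
    have hχm : StronglyAdapted ℱ χ := fun n => stronglyMeasurable_one.indicator (hs n)
    have hsub := hSsuper.neg.sum_mul_sub (R := 1) hχm
      (fun n ω => Set.indicator_le_self' (f := 1) (by simp) ω |>.trans (by simp))
      (fun n ω => Set.indicator_nonneg (by simp) ω)
    have hsup : Supermartingale
        (fun n => ∑ k ∈ Finset.range n, χ k * (S (k + 1) - S k)) ℱ μ := by
      have e : (fun n => ∑ k ∈ Finset.range n, χ k * (S (k + 1) - S k))
          = -fun n => ∑ k ∈ Finset.range n, χ k * ((-S) (k + 1) - (-S) k) := by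
        funext n
        rw [Pi.neg_apply, ← Finset.sum_neg_distrib]
        exact Finset.sum_congr rfl fun k _ => by simp only [Pi.neg_apply]; ring
      rw [e]
      exact hsub.neg
    have hsup2 : Supermartingale
        ((fun n => ∑ k ∈ Finset.range n, χ k * (S (k + 1) - S k)) + fun _ => X 0) ℱ μ :=
      hsup.add (martingale_const_fun ℱ μ (hXm 0) (hXi 0)).supermartingale
    -- On `s n` all earlier events hold too, since `ρ ≥ 0`, and the sum telescopes to `S (n + 1) ≥
    -- -C`; off `s n` the last increment is killed and the previous bound persists.
    have hb := Supermartingale.exists_ae_tendsto_of_le hsup2 (Nat.cast_nonneg C) (fun n => by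
      filter_upwards [hθ0, hρ0] with ω h1 h2
      have hS0 : S 0 ω = X 0 ω := by simp [hS]
      induction n with
      | zero =>
        simp only [Pi.add_apply, Finset.range_zero, Finset.sum_empty, Pi.zero_apply, zero_add]
        exact (neg_nonpos.2 (Nat.cast_nonneg C)).trans (hX 0 ω)
      | succ n ih =>
        simp only [Pi.add_apply, Finset.sum_apply, Pi.mul_apply, Pi.sub_apply] at ih ⊢
        by_cases h : ω ∈ s n
        · have hall : ∀ k ∈ Finset.range (n + 1),
              χ k ω * (S (k + 1) ω - S k ω) = S (k + 1) ω - S k ω := fun k hk => by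
            have : ω ∈ s k := by
              refine le_trans (Finset.sum_le_sum_of_subset_of_nonneg ?_ fun i _ _ => h2 i) h
              intro i hi
              simp at hi hk ⊢
              omega
            simp [hχ, this]
          rw [Finset.sum_congr rfl hall, Finset.sum_range_sub (fun k => S k ω), hS0]
          have h3 : S (n + 1) ω = X (n + 1) ω + ∑ k ∈ Finset.range (n + 1), θ k ω
              - ∑ k ∈ Finset.range (n + 1), ρ k ω := by
            simp [hS, Finset.sum_sub_distrib, add_sub_assoc]
          have h4 : 0 ≤ ∑ k ∈ Finset.range (n + 1), θ k ω := Finset.sum_nonneg fun k _ => h1 k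
          have h5 : ∑ k ∈ Finset.range (n + 1), ρ k ω ≤ C := h
          linarith [hX (n + 1) ω]
        · rw [Finset.sum_range_succ]
          have : χ n ω = 0 := by simp [hχ, h]
          rw [this]
          simpa using ih)
    filter_upwards [hb] with ω ⟨c, hc⟩ hω
    refine ⟨c, hc.congr fun n => ?_⟩
    have hS0 : S 0 ω = X 0 ω := by simp [hS]
    simp only [Pi.add_apply, Finset.sum_apply, Pi.mul_apply, Pi.sub_apply]
    have hall : ∀ k ∈ Finset.range n,
        χ k ω * (S (k + 1) ω - S k ω) = S (k + 1) ω - S k ω := fun k hk => by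
      have : ω ∈ s k := hω (k + 1)
      simp [hχ, this]
    rw [Finset.sum_congr rfl hall, Finset.sum_range_sub (fun k => S k ω), hS0]
    ring
  have main : ∀ᵐ ω ∂μ, (∃ c, Tendsto (fun n => X n ω) atTop (𝓝 c)) ∧
      Summable fun n => θ n ω := by
    filter_upwards [ae_all_iff.2 key, hθ0, hρ0, hsum] with ω h1 h2 h3 h4
    obtain ⟨C, hC⟩ := exists_nat_forall_sum_le h3 h4
    obtain ⟨c, hc⟩ := h1 C hC
    have hρt := h4.hasSum.tendsto_sum_nat
    -- Adding back the convergent sums of `ρ`; as both summands are nonnegative, boundedness makes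
    -- `θ` summable, and then `X` converges by subtraction.
    have h5 : Tendsto (fun n => X n ω + ∑ k ∈ Finset.range n, θ k ω) atTop
        (𝓝 (c + ∑' n, ρ n ω)) := by
      refine (hc.add hρt).congr fun n => ?_
      simp only [hS, Pi.add_apply, Finset.sum_apply, Pi.sub_apply, Finset.sum_sub_distrib]
      ring
    obtain ⟨M, hM⟩ := h5.bddAbove_range
    have h6 : Summable fun n => θ n ω := by
      refine summable_of_sum_range_le (c := M) h2 fun n => ?_
      have := hM ⟨n, rfl⟩
      simp only at this
      linarith [hX n ω]
    refine ⟨⟨_, (h5.sub h6.hasSum.tendsto_sum_nat).congr fun n => ?_⟩, h6⟩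
    ring
  have hTs := ae_summable_of_ae_summable_condExp ℱ hT hTi (main.mono fun ω h => h.2)
  filter_upwards [main, hTs] with ω h1 h2
  exact ⟨h1.1, h2⟩

/-- The Robbins–Siegmund theorem with deterministic multiplicative perturbations. -/
theorem robbins_siegmund [IsFiniteMeasure μ] (ℱ : Filtration ℕ m0) {α : ℕ → ℝ}
    {X T R : ℕ → Ω → ℝ} (hα : ∀ n, 0 ≤ α n) (hαs : Summable α)
    (hX : ∀ n ω, 0 ≤ X n ω) (hT : ∀ n ω, 0 ≤ T n ω) (hR : ∀ n ω, 0 ≤ R n ω)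
    (hXm : StronglyAdapted ℱ X)
    (hXi : ∀ n, Integrable (X n) μ) (hTi : ∀ n, Integrable (T n) μ)
    (hle : ∀ n, μ[X (n + 1) | ℱ n] + μ[T n | ℱ n] ≤ᵐ[μ] (1 + α n) • X n + μ[R n | ℱ n])
    (hsum : ∀ᵐ ω ∂μ, Summable fun n => (μ[R n | ℱ n]) ω) :
    ∀ᵐ ω ∂μ, (∃ c, Tendsto (fun n => X n ω) atTop (𝓝 c)) ∧ Summable fun n => T n ω := by
  set P : ℕ → ℝ := fun n => ∏ k ∈ Finset.range n, (1 + α k) with hP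
  have hP1 : ∀ n, 1 ≤ P n := fun n => Finset.one_le_prod fun k _ => by linarith [hα k]
  have hP0 : ∀ n, 0 < P n := fun n => one_pos.trans_le (hP1 n)
  have hPs : ∀ n, P (n + 1) = P n * (1 + α n) := fun n => Finset.prod_range_succ _ _
  have hPmono : Monotone P := monotone_nat_of_le_succ fun n => by
    rw [hPs]; exact le_mul_of_one_le_right (hP0 n).le (by linarith [hα n])
  have hPb : ∀ n, P n ≤ Real.exp (∑' k, α k) := fun n => by
    calc P n ≤ ∏ k ∈ Finset.range n, Real.exp (α k) :=
          Finset.prod_le_prod (fun k _ => by linarith [hα k])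
            fun k _ => by linarith [Real.add_one_le_exp (α k)]
      _ = Real.exp (∑ k ∈ Finset.range n, α k) := (Real.exp_sum _ _).symm
      _ ≤ _ := Real.exp_le_exp.2 (hαs.sum_le_tsum _ fun k _ => hα k)
  have hPlim : Tendsto P atTop (𝓝 (⨆ n, P n)) :=
    tendsto_atTop_ciSup hPmono ⟨_, Set.forall_mem_range.2 hPb⟩
  have hinv : ∀ n, 0 ≤ (P n)⁻¹ := fun n => (inv_pos.2 (hP0 n)).le
  -- Dividing the inequality by `P (n + 1) = P n * (1 + α n)` absorbs the factor `1 + α n`; as `1 ≤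
  -- P n ≤ exp (∑ α)`, the rescaling can be undone.
  have h := robbins_siegmund_additive (μ := μ) ℱ (X := fun n => (P n)⁻¹ • X n)
    (T := fun n => (P (n + 1))⁻¹ • T n) (R := fun n => (P (n + 1))⁻¹ • R n)
    (fun n ω => mul_nonneg (hinv n) (hX n ω)) (fun n ω => mul_nonneg (hinv _) (hT n ω))
    (fun n ω => mul_nonneg (hinv _) (hR n ω)) (fun n => (hXm n).const_smul _)
    (fun n => (hXi n).smul _) (fun n => (hTi n).smul _) (fun n => by
      filter_upwards [hle n, condExp_smul (μ := μ) (P (n + 1))⁻¹ (X (n + 1)) (ℱ n),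
        condExp_smul (μ := μ) (P (n + 1))⁻¹ (T n) (ℱ n),
        condExp_smul (μ := μ) (P (n + 1))⁻¹ (R n) (ℱ n)] with ω h1 h2 h3 h4
      simp only [Pi.add_apply, Pi.smul_apply, smul_eq_mul] at h1 h2 h3 h4 ⊢
      rw [h2, h3, h4]
      have h5 := mul_le_mul_of_nonneg_left h1 (hinv (n + 1))
      have h6 : (P (n + 1))⁻¹ * (1 + α n) = (P n)⁻¹ := by
        have := (hP0 n).ne'
        have h' : 1 + α n ≠ 0 := by linarith [hα n]
        rw [hPs]
        field_simp
      rw [← h6]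
      linarith)
    (by
      have h7 : ∀ᵐ ω ∂μ, ∀ n, (μ[(P (n + 1))⁻¹ • R n | ℱ n]) ω
          = (P (n + 1))⁻¹ * (μ[R n | ℱ n]) ω := ae_all_iff.2 fun n =>
        condExp_smul (μ := μ) (P (n + 1))⁻¹ (R n) (ℱ n)
      have h8 : ∀ᵐ ω ∂μ, ∀ n, 0 ≤ (μ[R n | ℱ n]) ω := ae_all_iff.2 fun n =>
        condExp_nonneg (Eventually.of_forall (hR n))
      filter_upwards [hsum, h7, h8] with ω h1 h2 h3
      refine Summable.of_nonneg_of_le (fun n => ?_) (fun n => ?_) h1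
      · rw [h2]; exact mul_nonneg (hinv _) (h3 n)
      · rw [h2]; exact mul_le_of_le_one_left (h3 n) (inv_le_one_of_one_le₀ (hP1 _)))
  filter_upwards [h] with ω ⟨⟨c, hc⟩, h2⟩
  refine ⟨⟨_, (hPlim.mul hc).congr fun n => ?_⟩, ?_⟩
  · simp only [Pi.smul_apply, smul_eq_mul]
    rw [mul_inv_cancel_left₀ (hP0 n).ne']
  · refine Summable.of_nonneg_of_le (hT · ω) (fun n => ?_) (h2.mul_left (Real.exp (∑' k, α k)))
    simp only [Pi.smul_apply, smul_eq_mul]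
    calc T n ω = P (n + 1) * ((P (n + 1))⁻¹ * T n ω) := by
          rw [mul_inv_cancel_left₀ (hP0 _).ne']
      _ ≤ _ := mul_le_mul_of_nonneg_right (hPb _) (mul_nonneg (hinv _) (hT n ω))

end Probability

/-! ### Weak convergence, Opial's lemma, measurability of weak limits. -/

section Weak

variable {K : Type*} [NormedAddCommGroup K] [InnerProductSpace ℝ K]

/-- Weak convergence along a filter in a real inner product space. -/
def WeakTendsto {ι : Type*} (v : ι → K) (l : Filter ι) (p : K) : Prop :=
  ∀ y : K, Tendsto (fun i => ⟪y, v i⟫) l (𝓝 ⟪y, p⟫)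

lemma WeakTendsto.mono {ι : Type*} {v : ι → K} {l l' : Filter ι} {p : K}
    (h : WeakTendsto v l p) (hl : l' ≤ l) : WeakTendsto v l' p :=
  fun y => (h y).mono_left hl

lemma weakTendsto_of_tendsto {ι : Type*} {v : ι → K} {l : Filter ι} {p : K}
    (h : Tendsto v l (𝓝 p)) : WeakTendsto v l p :=
  fun _ => tendsto_const_nhds.inner h

lemma WeakTendsto.sub {ι : Type*} {v u : ι → K} {l : Filter ι} {p q : K}
    (h : WeakTendsto v l p) (h' : WeakTendsto u l q) :
    WeakTendsto (fun i => v i - u i) l (p - q) := fun y => by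
  simpa only [inner_sub_right] using (h y).sub (h' y)

/-- The inner product of a bounded weakly convergent family with a norm convergent one. -/
lemma WeakTendsto.inner {ι : Type*} {v u : ι → K} {l : Filter ι} {p q : K} {M : ℝ}
    (h : WeakTendsto v l p) (hM : ∀ᶠ i in l, ‖v i‖ ≤ M) (hu : Tendsto u l (𝓝 q)) :
    Tendsto (fun i => ⟪u i, v i⟫) l (𝓝 ⟪q, p⟫) := by
  have h0 : Tendsto (fun i => ⟪u i - q, v i⟫) l (𝓝 0) := by
    have h1 : Tendsto (fun i => ‖u i - q‖ * M) l (𝓝 0) := by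
      simpa using (tendsto_iff_norm_sub_tendsto_zero.1 hu).mul_const M
    refine squeeze_zero_norm' ?_ h1
    filter_upwards [hM] with i hi
    exact (norm_inner_le_norm _ _).trans (mul_le_mul_of_nonneg_left hi (norm_nonneg _))
  have := h0.add (h q)
  simpa [inner_sub_left] using this

/-- By the Riesz representation every continuous functional is an inner product. -/
lemma WeakTendsto.toWeakSpace [CompleteSpace K] {ι : Type*} {v : ι → K} {l : Filter ι} {p : K}
    (h : WeakTendsto v l p) :
    Tendsto (fun i => toWeakSpace ℝ K (v i)) l (𝓝 (toWeakSpace ℝ K p)) := by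
  have hinj : Function.Injective ((topDualPairing ℝ K).flip) := by
    intro a b hab
    refine ext_inner_left ℝ fun y => ?_
    exact LinearMap.congr_fun hab (InnerProductSpace.toDual ℝ K y)
  refine (WeakBilin.tendsto_iff_forall_eval_tendsto _ hinj).2 fun f => ?_
  have := h ((InnerProductSpace.toDual ℝ K).symm f)
  simp only [InnerProductSpace.toDual_symm_apply] at this
  exact this

/-- Bounded families converge weakly along ultrafilters. -/
lemma exists_weakTendsto_ultrafilter [CompleteSpace K] {ι : Type*} {v : ι → K} {M : ℝ}
    (hM : ∀ i, ‖v i‖ ≤ M) (f : Ultrafilter ι) : ∃ p, WeakTendsto v f p := by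
  let φ : ι → WeakDual ℝ K := fun i =>
    StrongDual.toWeakDual (InnerProductSpace.toDual ℝ K (v i))
  -- Banach–Alaoglu in the dual, transported back by the Riesz isometry.
  have hc := WeakDual.isCompact_closedBall (𝕜 := ℝ) (E := K) 0 M
  obtain ⟨x, -, hx⟩ := hc.ultrafilter_le_nhds (f.map φ) (by
    rw [le_principal_iff]
    refine Ultrafilter.mem_map.2 (Filter.mem_of_superset Filter.univ_mem fun i _ => ?_)
    simpa [φ] using hM i)
  refine ⟨(InnerProductSpace.toDual ℝ K).symm (WeakDual.toStrongDual x), fun y => ?_⟩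
  have h2 : Tendsto φ f (𝓝 x) := hx
  have h3 := tendsto_iff_forall_eval_tendsto_topDualPairing.1 h2 y
  rw [real_inner_comm, InnerProductSpace.toDual_symm_apply]
  refine h3.congr fun i => ?_
  rw [real_inner_comm]
  rfl

/-- A closed subspace equals its double orthogonal, so membership is tested by inner products. -/
lemma WeakTendsto.mem_of_forall_mem [CompleteSpace K] {ι : Type*} {v : ι → K} {l : Filter ι}
    [l.NeBot] {p : K} (h : WeakTendsto v l p) {S : Submodule ℝ K} (hS : IsClosed (S : Set K))
    (hv : ∀ i, v i ∈ S) : p ∈ S := by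
  have : CompleteSpace S := hS.completeSpace_coe
  rw [← S.orthogonal_orthogonal]
  refine (Submodule.mem_orthogonal _ _).2 fun y hy => ?_
  refine tendsto_nhds_unique (h y) ?_
  have : ∀ i, ⟪y, v i⟫ = 0 := fun i => (Submodule.mem_orthogonal' _ _).1 hy _ (hv i)
  simp [this]

/-- An Opial type lemma for the metric induced by `V`. -/
theorem exists_weakTendsto_of_opial [CompleteSpace K] {V : K →L[ℝ] K}
    (hVs : ∀ x y, ⟪V x, y⟫ = ⟪x, V y⟫) (hV : ∀ x, ⟪V x, x⟫ = 0 → x = 0)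
    {v : ℕ → K} {M : ℝ} (hM : ∀ n, ‖v n‖ ≤ M) {D : Set K}
    (hD : ∀ x ∈ D, ∃ c, Tendsto (fun n => ⟪V (v n - x), v n - x⟫) atTop (𝓝 c))
    (hclus : ∀ (f : Ultrafilter ℕ) (p : K), (f : Filter ℕ) ≤ atTop → WeakTendsto v f p →
      p ∈ closure D) :
    ∃ p, WeakTendsto v atTop p := by
  have key : ∀ (f g : Ultrafilter ℕ) (p q : K), (f : Filter ℕ) ≤ atTop → (g : Filter ℕ) ≤ atTop →
      WeakTendsto v f p → WeakTendsto v g q → p = q := by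
    intro f g p q hf hg hp hq
    -- The difference of the squared distances to `y` and `x` is affine in `v n`, with linear part
    -- `2 ⟪V (x - y), v n⟫`. This therefore converges, and takes the same limit along `f` and `g`.
    -- Passing to the closure allows `x = p`, `y = q`.
    have h1 : ∀ x ∈ D, ∀ y ∈ D, ⟪V (x - y), p - q⟫ = 0 := by
      intro x hx y hy
      obtain ⟨c, hc⟩ := hD x hx
      obtain ⟨d, hd⟩ := hD y hy
      have h2 : Tendsto (fun n => ⟪V (x - y), v n⟫) atTop
          (𝓝 ((d - c + ⟪V x, x⟫ - ⟪V y, y⟫) / 2)) := by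
        refine ((((hd.sub hc).add_const ⟪V x, x⟫).sub_const ⟪V y, y⟫).div_const 2).congr
          fun n => ?_
        have e1 := hVs (v n) x
        have e2 := hVs (v n) y
        rw [real_inner_comm] at e1 e2
        simp only [map_sub, inner_sub_left, inner_sub_right]
        have e3 : ⟪V (v n), x⟫ = ⟪V x, v n⟫ := by rw [real_inner_comm, e1, real_inner_comm]
        have e4 : ⟪V (v n), y⟫ = ⟪V y, v n⟫ := by rw [real_inner_comm, e2, real_inner_comm]
        rw [e3, e4]
        ring
      have h3 := tendsto_nhds_unique (hp (V (x - y))) (h2.mono_left hf)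
      have h4 := tendsto_nhds_unique (hq (V (x - y))) (h2.mono_left hg)
      rw [inner_sub_right, h3, h4, sub_self]
    have h2 : ∀ x ∈ closure D, ∀ y ∈ closure D, ⟪V (x - y), p - q⟫ = 0 := by
      intro x hx y hy
      have hcl : IsClosed {z : K × K | ⟪V (z.1 - z.2), p - q⟫ = 0} :=
        isClosed_eq (by fun_prop) continuous_const
      have hsub : D ×ˢ D ⊆ {z : K × K | ⟪V (z.1 - z.2), p - q⟫ = 0} :=
        fun z hz => h1 z.1 hz.1 z.2 hz.2
      have := closure_minimal hsub hcl
      rw [closure_prod_eq] at this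
      exact this (Set.mk_mem_prod hx hy)
    exact sub_eq_zero.1 (hV _ (h2 p (hclus f p hf hp) q (hclus g q hg hq)))
  let f₀ : Ultrafilter ℕ := Ultrafilter.of atTop
  obtain ⟨p, hp⟩ := exists_weakTendsto_ultrafilter hM f₀
  refine ⟨p, fun y => (tendsto_iff_ultrafilter _ _ _).2 fun g hg => ?_⟩
  obtain ⟨q, hq⟩ := exists_weakTendsto_ultrafilter hM g
  rw [key f₀ g p q (Ultrafilter.of_le _) hg hp hq]
  exact hq y

/-- A finite-rank projection involves finitely many inner products, so it turns weak convergence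
into norm convergence. -/
lemma WeakTendsto.starProjection {ι : Type*} {v : ι → K} {l : Filter ι} {p : K}
    (h : WeakTendsto v l p) (S : Submodule ℝ K) [FiniteDimensional ℝ S] :
    Tendsto (fun i => S.starProjection (v i)) l (𝓝 (S.starProjection p)) := by
  have e : ∀ x, S.starProjection x = ∑ i, ⟪(stdOrthonormalBasis ℝ S i : K), x⟫ •
      (stdOrthonormalBasis ℝ S i : K) := fun x => by
    rw [Submodule.starProjection_apply,
      (stdOrthonormalBasis ℝ S).orthogonalProjectionOnto_apply_eq_sum]
    simp
  simp_rw [e]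
  exact tendsto_finsetSum _ fun i _ => (h _).smul_const _

/-- An a.e. weak limit of strongly measurable functions is a.e. strongly measurable. -/
theorem aestronglyMeasurable_of_weakTendsto [CompleteSpace K] {Ω : Type*} {m0 : MeasurableSpace Ω}
    {μ : Measure Ω} {w : ℕ → Ω → K} (hw : ∀ n, StronglyMeasurable (w n)) {p : Ω → K}
    (h : ∀ᵐ ω ∂μ, WeakTendsto (fun n => w n ω) atTop (p ω)) : AEStronglyMeasurable p μ := by
  have hsep : TopologicalSpace.IsSeparable (⋃ n, Set.range (w n)) :=
    TopologicalSpace.IsSeparable.iUnion fun n => (hw n).isSeparable_range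
  obtain ⟨t, htc, ht⟩ := hsep
  obtain ⟨d, hd⟩ := (htc.insert 0).exists_eq_range (Set.insert_nonempty 0 t)
  -- Finite-dimensional spaces whose union is dense in a closed subspace containing all `w n ω`,
  -- hence `p ω`; so the projections of `p ω` onto them tend to `p ω`.
  let S : ℕ → Submodule ℝ K := fun k => Submodule.span ℝ (d '' Set.Iic k)
  have hfin : ∀ k, FiniteDimensional ℝ (S k) := fun k =>
    FiniteDimensional.span_of_finite ℝ ((Set.finite_Iic k).image d)
  have hmono : Monotone S := fun i j hij =>
    Submodule.span_mono (Set.image_mono (Set.Iic_subset_Iic.2 hij))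
  have hsub : t ⊆ ((⨆ k, S k : Submodule ℝ K) : Set K) := fun x hx => by
    obtain ⟨k, rfl⟩ : x ∈ Set.range d := hd ▸ Set.mem_insert_of_mem 0 hx
    exact Submodule.mem_iSup_of_mem k
      (Submodule.subset_span (Set.mem_image_of_mem d (Set.mem_Iic.2 le_rfl)))
  have hwS : ∀ n ω, w n ω ∈ (⨆ k, S k).topologicalClosure := fun n ω =>
    closure_mono hsub (ht (Set.mem_iUnion.2 ⟨n, ω, rfl⟩))
  have h1 : ∀ k, AEStronglyMeasurable (fun ω => (S k).starProjection (p ω)) μ := fun k =>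
    aestronglyMeasurable_of_tendsto_ae atTop
      (fun n => ((S k).starProjection.continuous.comp_stronglyMeasurable
        (hw n)).aestronglyMeasurable)
      (h.mono fun ω hω => hω.starProjection (S k))
  refine aestronglyMeasurable_of_tendsto_ae atTop h1 ?_
  filter_upwards [h] with ω hω
  have hp := hω.mem_of_forall_mem (Submodule.isClosed_topologicalClosure _) (fun n => hwS n ω)
  have h2 := Submodule.starProjection_tendsto_closure_iSup S hmono (p ω)
  rwa [Submodule.starProjection_eq_self_iff.2 hp] at h2

end Weak

/-! ### The metric of the inverse preconditioner. -/

section OperatorFacts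

variable {K : Type*} [NormedAddCommGroup K] [InnerProductSpace ℝ K]

/-- `V` is a symmetric inverse of `U`, with `⟪V x, x⟫ ≥ c ‖x‖ ^ 2`, `c > 0`. -/
structure IsMetricInverse (U V : K →L[ℝ] K) (c : ℝ) : Prop where
  pos : 0 < c
  left_inv : ∀ x, V (U x) = x
  right_inv : ∀ x, U (V x) = x
  symm : ∀ x y, ⟪V x, y⟫ = ⟪x, V y⟫
  coercive : ∀ x, c * ‖x‖ ^ 2 ≤ ⟪V x, x⟫

/-- Strong positivity makes `U` invertible. With `x = U y`, `⟪V x, x⟫ = ⟪U y, y⟫ ≥ χ ‖y‖ ^ 2`, and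
`‖y‖` is bounded below through `‖U‖`; the `+ 1` in the constant covers `‖U‖ = 0`. -/
lemma exists_isMetricInverse [CompleteSpace K] {U : K →L[ℝ] K} (hU : IsSelfAdjoint U)
    (hpos : IsStronglyPositive U) : ∃ V c, IsMetricInverse U V c := by
  obtain ⟨χ, hχ, h⟩ := hpos
  have hu : IsUnit U := by
    refine ContinuousLinearMap.isUnit_of_forall_le_norm_inner_map U
      (c := ⟨χ, hχ.le⟩) hχ fun x => ?_
    rw [mul_comm]
    exact (h x).trans (le_abs_self _)
  obtain ⟨u, rfl⟩ := hu
  have hsymm : ∀ x y, ⟪(u : K →L[ℝ] K) x, y⟫ = ⟪x, (u : K →L[ℝ] K) y⟫ := hU.isSymmetric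
  have hl : ∀ x, (↑u⁻¹ : K →L[ℝ] K) ((u : K →L[ℝ] K) x) = x := fun x =>
    DFunLike.congr_fun u.inv_mul x
  have hr : ∀ x, (u : K →L[ℝ] K) ((↑u⁻¹ : K →L[ℝ] K) x) = x := fun x =>
    DFunLike.congr_fun u.mul_inv x
  set N := ‖(u : K →L[ℝ] K)‖ with hN
  have hd : 0 < N ^ 2 + 1 := by positivity
  refine ⟨(↑u⁻¹ : K →L[ℝ] K), χ / (N ^ 2 + 1), by positivity, hl, hr, fun x y => ?_, fun x => ?_⟩
  · conv_lhs => rw [← hr y]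
    rw [← hsymm, hr]
  · set y := (↑u⁻¹ : K →L[ℝ] K) x with hy
    have hx : x = (u : K →L[ℝ] K) y := (hr x).symm
    have h1 : ‖x‖ ≤ N * ‖y‖ := hx ▸ (u : K →L[ℝ] K).le_opNorm y
    have h2 : ‖x‖ ^ 2 ≤ (N ^ 2 + 1) * ‖y‖ ^ 2 := by
      nlinarith [norm_nonneg x, pow_le_pow_left₀ (norm_nonneg x) h1 2, sq_nonneg ‖y‖]
    have h3 : ⟪y, x⟫ = ⟪(u : K →L[ℝ] K) y, y⟫ := by rw [real_inner_comm, ← hx]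
    rw [h3]
    refine le_trans ?_ (h y)
    rw [div_mul_eq_mul_div, div_le_iff₀ hd]
    nlinarith

namespace IsMetricInverse

variable {U V : K →L[ℝ] K} {c : ℝ}

lemma inner_self_nonneg (h : IsMetricInverse U V c) (x : K) : 0 ≤ ⟪V x, x⟫ :=
  (mul_nonneg h.pos.le (sq_nonneg _)).trans (h.coercive x)

lemma inner_add_add (h : IsMetricInverse U V c) (a b : K) :
    ⟪V (a + b), a + b⟫ = ⟪V a, a⟫ + 2 * ⟪V a, b⟫ + ⟪V b, b⟫ := by
  have : ⟪V b, a⟫ = ⟪V a, b⟫ := by rw [h.symm, real_inner_comm]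
  simp only [map_add, inner_add_left, inner_add_right, this]
  ring

lemma inner_sub_smul (h : IsMetricInverse U V c) (a b : K) (t : ℝ) :
    ⟪V (a - t • U b), a - t • U b⟫ = ⟪V a, a⟫ - 2 * t * ⟪a, b⟫ + t ^ 2 * ⟪U b, b⟫ := by
  have h1 : ⟪V a, U b⟫ = ⟪a, b⟫ := by rw [h.symm, h.left_inv]
  simp only [map_sub, map_smul, inner_sub_left, inner_sub_right, inner_smul_left,
    inner_smul_right, h1, h.left_inv, real_inner_comm b a, real_inner_comm (U b) b]
  simp only [conj_trivial, real_inner_comm]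
  ring

/-- The forward step `x ↦ x - t U B x` decreases the metric induced by `V`. -/
lemma inner_forward_le (h : IsMetricInverse U V c) {β ε t : ℝ} (hβ : 0 < β) (hε : 0 < ε)
    (ht : ε ≤ t) (htU : t * ‖U‖ ≤ (2 - ε) * β) {a b : K} (hab : β * ‖b‖ ^ 2 ≤ ⟪a, b⟫) :
    ⟪V (a - t • U b), a - t • U b⟫ ≤ ⟪V a, a⟫ - ε ^ 2 * β * ‖b‖ ^ 2 := by
  rw [h.inner_sub_smul]
  have ht0 : 0 < t := hε.trans_le ht
  have h1 : ⟪U b, b⟫ ≤ ‖U‖ * ‖b‖ ^ 2 := by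
    refine (real_inner_le_norm _ _).trans ?_
    rw [pow_two, ← mul_assoc]
    exact mul_le_mul_of_nonneg_right (U.le_opNorm b) (norm_nonneg _)
  -- The quadratic term costs at most this much, while cocoercivity makes the cross term gain `2 t β
  -- ‖b‖ ^ 2`; the surplus `t ε β ‖b‖ ^ 2` is at least `ε ^ 2 β ‖b‖ ^ 2`.
  have h2 : t ^ 2 * ⟪U b, b⟫ ≤ t * ((2 - ε) * β * ‖b‖ ^ 2) := by
    calc t ^ 2 * ⟪U b, b⟫ ≤ t ^ 2 * (‖U‖ * ‖b‖ ^ 2) := by gcongr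
      _ = t * (t * ‖U‖ * ‖b‖ ^ 2) := by ring
      _ ≤ _ := by gcongr
  have h3 : ε ^ 2 * β * ‖b‖ ^ 2 ≤ t * (ε * β * ‖b‖ ^ 2) := by
    have : ε * (ε * β * ‖b‖ ^ 2) ≤ t * (ε * β * ‖b‖ ^ 2) := by gcongr
    linarith
  have h4 : t * (β * ‖b‖ ^ 2) ≤ t * ⟪a, b⟫ := by gcongr
  linarith

/-- Positivity at `a - b` bounds the cross term, and `t ^ 2 ≤ t`. This isolates the inertia as a
factor `1 + α n` and a summable remainder. -/
lemma inner_add_smul_le (h : IsMetricInverse U V c) {a b : K} {t : ℝ} (ht : 0 ≤ t)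
    (ht1 : t ≤ 1) :
    ⟪V (a + t • b), a + t • b⟫ ≤ (1 + t) * ⟪V a, a⟫ + 2 * t * ⟪V b, b⟫ := by
  have h1 := h.inner_self_nonneg (a + -b)
  rw [h.inner_add_add] at h1 ⊢
  simp only [map_neg, inner_neg_left, inner_neg_right, neg_neg, map_smul, inner_smul_left,
    inner_smul_right, conj_trivial] at h1 ⊢
  have h2 : t * (t * ⟪V b, b⟫) ≤ t * ⟪V b, b⟫ :=
    mul_le_mul_of_nonneg_left (mul_le_of_le_one_left (h.inner_self_nonneg b) ht1) ht
  have h3 : 0 ≤ t * (⟪V a, a⟫ + 2 * -⟪V a, b⟫ + ⟪V b, b⟫) := mul_nonneg ht h1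
  linarith

lemma norm_sub_le_of_inner_le (h : IsMetricInverse U V c) {x y : K}
    (hxy : ⟪V x, x⟫ ≤ ⟪V y, x⟫) : ‖x‖ ≤ ‖V‖ / c * ‖y‖ := by
  have h1 : c * ‖x‖ ^ 2 ≤ ‖V‖ * ‖y‖ * ‖x‖ := by
    refine (h.coercive x).trans (hxy.trans ((real_inner_le_norm _ _).trans ?_))
    exact mul_le_mul_of_nonneg_right (V.le_opNorm y) (norm_nonneg _)
  rw [div_mul_eq_mul_div, le_div_iff₀ h.pos]
  rcases (norm_nonneg x).eq_or_lt with h0 | h0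
  · rw [← h0, zero_mul]; positivity
  · refine le_of_mul_le_mul_right ?_ h0
    linarith

end IsMetricInverse

/-! ### Monotone and cocoercive operators; the one-step inequality. -/

section Monotone

variable {A : K → Set K} {B : K → K} {β : ℝ}

/-- Adjoining `(p, a)` to the graph keeps it monotone, so maximality forces the pair to be there
already. -/
lemma IsMaximallyMonotone.mem_of_forall (hA : IsMaximallyMonotone A) {p a : K}
    (h : ∀ z, ∀ v ∈ A z, 0 ≤ ⟪v - a, z - p⟫) : a ∈ A p := by
  have hmono : IsMonotoneOp (fun z => A z ∪ {v | z = p ∧ v = a}) := by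
    rintro z₁ z₂ v₁ (h₁ | ⟨rfl, rfl⟩) v₂ (h₂ | ⟨rfl, rfl⟩)
    · exact hA.1 z₁ z₂ v₁ h₁ v₂ h₂
    · exact h _ _ h₁
    · rw [← neg_sub v₂, ← neg_sub z₂, inner_neg_neg]
      exact h _ _ h₂
    · simp
  exact hA.2 hmono (fun z => Set.subset_union_left) p (Or.inr ⟨rfl, rfl⟩)

/-- The graph of a maximally monotone operator is closed for the weak-strong topology along
bounded families. -/
lemma IsMaximallyMonotone.mem_of_weakTendsto (hA : IsMaximallyMonotone A) {ι : Type*}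
    {l : Filter ι} [l.NeBot] {v a : ι → K} {p q : K} {M : ℝ} (hva : ∀ i, a i ∈ A (v i))
    (hv : WeakTendsto v l p) (hM : ∀ i, ‖v i‖ ≤ M) (ha : Tendsto a l (𝓝 q)) : q ∈ A p := by
  refine hA.mem_of_forall fun z y hy => ?_
  have h1 : WeakTendsto (fun i => z - v i) l (z - p) :=
    (weakTendsto_of_tendsto tendsto_const_nhds).sub hv
  have h2 := h1.inner (M := ‖z‖ + M)
    (Eventually.of_forall fun i => (norm_sub_le _ _).trans (by gcongr; exact hM i))
    (tendsto_const_nhds (x := y).sub ha)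
  exact ge_of_tendsto' h2 fun i => hA.1 _ _ _ hy _ (hva i)

lemma IsCocoercive.norm_map_sub_le (hβ : 0 < β) (hB : IsCocoercive β B) (x y : K) :
    ‖B x - B y‖ ≤ β⁻¹ * ‖x - y‖ := by
  have h := (hB x y).trans (real_inner_le_norm _ _)
  rw [inv_mul_eq_div, le_div_iff₀ hβ]
  rcases (norm_nonneg (B x - B y)).eq_or_lt with h0 | h0
  · rw [← h0, zero_mul]; positivity
  · refine le_of_mul_le_mul_right ?_ h0
    linarith

lemma IsCocoercive.continuous (hβ : 0 < β) (hB : IsCocoercive β B) : Continuous B :=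
  (LipschitzWith.of_dist_le_mul (K := β⁻¹.toNNReal) fun x y => by
    rw [dist_eq_norm, dist_eq_norm, Real.coe_toNNReal _ (inv_pos.2 hβ).le]
    exact hB.norm_map_sub_le hβ x y).continuous

/-- Cocoercivity bounds `β ‖B (v i) - B p‖ ^ 2` by the pairing of a bounded weakly null family with
a norm convergent one, which tends to `0`. -/
lemma IsCocoercive.eq_of_weakTendsto (hβ : 0 < β) (hB : IsCocoercive β B) {ι : Type*}
    {l : Filter ι} [l.NeBot] {v : ι → K} {p q : K} {M : ℝ}
    (hv : WeakTendsto v l p) (hM : ∀ i, ‖v i‖ ≤ M) (hq : Tendsto (fun i => B (v i)) l (𝓝 q)) :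
    q = B p := by
  have h1 : WeakTendsto (fun i => v i - p) l (p - p) :=
    hv.sub (weakTendsto_of_tendsto tendsto_const_nhds)
  have h2 := h1.inner (M := M + ‖p‖)
    (Eventually.of_forall fun i => (norm_sub_le _ _).trans (by gcongr; exact hM i))
    (hq.sub_const (B p))
  rw [sub_self, inner_zero_right] at h2
  have h3 : Tendsto (fun i => β * ‖B (v i) - B p‖ ^ 2) l (𝓝 (β * ‖q - B p‖ ^ 2)) :=
    ((hq.sub_const (B p)).norm.pow 2).const_mul β
  have h4 : β * ‖q - B p‖ ^ 2 ≤ 0 := le_of_tendsto_of_tendsto' h3 h2 fun i => by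
    rw [real_inner_comm]
    exact hB _ _
  have h5 : ‖q - B p‖ ^ 2 ≤ 0 := by
    by_contra hc
    exact absurd h4 (not_le.2 (mul_pos hβ (not_le.1 hc)))
  have h6 := (pow_eq_zero_iff two_ne_zero).1 (le_antisymm h5 (sq_nonneg _))
  exact sub_eq_zero.1 (norm_eq_zero.1 h6)

/-- Norm convergence at a point of uniform monotonicity. -/
lemma IsUniformlyMonotoneAt.tendsto_norm {p : K} (hB : IsUniformlyMonotoneAt B p) {v : ℕ → K}
    {M : ℝ} (hM : ∀ n, ‖v n‖ ≤ M) (hBv : Tendsto (fun n => B (v n)) atTop (𝓝 (B p))) :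
    Tendsto (fun n => ‖v n - p‖) atTop (𝓝 0) := by
  obtain ⟨φ, hφ, hφ0, h⟩ := hB
  have h1 : Tendsto (fun n => ⟪p - v n, B p - B (v n)⟫) atTop (𝓝 0) := by
    have h2 : Tendsto (fun n => (‖p‖ + M) * ‖B p - B (v n)‖) atTop (𝓝 0) := by
      simpa using ((hBv.const_sub (B p)).norm).const_mul (‖p‖ + M)
    refine squeeze_zero_norm (fun n => ?_) h2
    refine (norm_inner_le_norm _ _).trans ?_
    gcongr
    exact (norm_sub_le _ _).trans (by gcongr; exact hM n)
  rw [Metric.tendsto_atTop]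
  intro δ hδ
  have hφδ : 0 < φ δ.toNNReal := by
    refine pos_iff_ne_zero.2 fun h0 => hδ.ne' ?_
    exact le_antisymm (Real.toNNReal_eq_zero.1 ((hφ0 _).1 h0)) hδ.le
  -- If `‖v n - p‖ ≥ δ`, monotonicity of `φ` would keep the inner product at least `φ δ > 0`.
  have h3 : ∀ᶠ n in atTop, ENNReal.ofReal ⟪p - v n, B p - B (v n)⟫ < φ δ.toNNReal := by
    have := (ENNReal.continuous_ofReal.tendsto 0).comp h1
    rw [ENNReal.ofReal_zero] at this
    exact this.eventually (gt_mem_nhds hφδ)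
  obtain ⟨N, hN⟩ := eventually_atTop.1 h3
  refine ⟨N, fun n hn => ?_⟩
  rw [Real.dist_eq, sub_zero, abs_norm]
  by_contra! hc
  have h4 : φ δ.toNNReal ≤ φ ‖p - v n‖₊ := hφ (by
    rw [← NNReal.coe_le_coe, Real.coe_toNNReal _ hδ.le, coe_nnnorm, norm_sub_rev]
    exact hc)
  have h5 : (φ ‖p - v n‖₊ : EReal) ≤ (ENNReal.ofReal ⟪p - v n, B p - B (v n)⟫ : EReal) := by
    refine (h (v n)).trans ?_
    rw [EReal.coe_ennreal_ofReal]
    exact_mod_cast le_max_left _ _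
  exact absurd (hN n hn) (not_lt.2 (h4.trans (EReal.coe_ennreal_le_coe_ennreal_iff.1 h5)))

lemma mem_resolvent_precond_iff {γ : ℝ} {U : K →L[ℝ] K} {x y : K} :
    y ∈ resolvent (precond γ U A) x ↔ ∃ a ∈ A y, x = y + γ • U a := by
  simp [resolvent, precond]

variable {U V : K →L[ℝ] K} {c : ℝ}

/-- Firm nonexpansiveness of the resolvent of `γ U A` for the metric induced by `V`. -/
lemma IsMetricInverse.inner_sub_nonneg (h : IsMetricInverse U V c) (hA : IsMonotoneOp A) {γ : ℝ}
    (hγ : 0 ≤ γ) {x₁ x₂ y₁ y₂ : K} (h₁ : y₁ ∈ resolvent (precond γ U A) x₁)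
    (h₂ : y₂ ∈ resolvent (precond γ U A) x₂) :
    0 ≤ ⟪V ((x₁ - y₁) - (x₂ - y₂)), y₁ - y₂⟫ := by
  obtain ⟨a₁, ha₁, rfl⟩ := mem_resolvent_precond_iff.1 h₁
  obtain ⟨a₂, ha₂, rfl⟩ := mem_resolvent_precond_iff.1 h₂
  simp only [add_sub_cancel_left, ← smul_sub, ← map_sub, map_smul, h.left_inv, inner_smul_left]
  exact mul_nonneg hγ (hA _ _ _ ha₁ _ ha₂)

/-- The constant is not `1` because the original norm is used. The bound transfers measurability and
square integrability to the iterates. -/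
lemma IsMetricInverse.norm_resolvent_sub_le (h : IsMetricInverse U V c) (hA : IsMonotoneOp A)
    {γ : ℝ} (hγ : 0 ≤ γ) {x₁ x₂ y₁ y₂ : K} (h₁ : y₁ ∈ resolvent (precond γ U A) x₁)
    (h₂ : y₂ ∈ resolvent (precond γ U A) x₂) : ‖y₁ - y₂‖ ≤ ‖V‖ / c * ‖x₁ - x₂‖ := by
  refine h.norm_sub_le_of_inner_le ?_
  have h1 := h.inner_sub_nonneg hA hγ h₁ h₂
  have e : x₁ - y₁ - (x₂ - y₂) = (x₁ - x₂) - (y₁ - y₂) := by abel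
  rw [e, map_sub, inner_sub_left] at h1
  linarith

lemma mem_resolvent_of_mem_zeros {x : K} (hx : x ∈ zeros A B) (γ : ℝ) (U : K →L[ℝ] K) :
    x ∈ resolvent (precond γ U A) (x - γ • U (B x)) := by
  obtain ⟨a, ha, h⟩ := hx
  refine mem_resolvent_precond_iff.2 ⟨a, ha, ?_⟩
  rw [eq_neg_of_add_eq_zero_left h, map_neg, smul_neg, sub_eq_add_neg]

/-- The basic pathwise estimate for one step of the algorithm. -/
lemma IsMetricInverse.step_le (h : IsMetricInverse U V c) (hA : IsMonotoneOp A) (hβ : 0 < β)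
    (hB : IsCocoercive β B) {ε γ α : ℝ} (hε : 0 < ε) (hγ : ε ≤ γ) (hγU : γ * ‖U‖ ≤ (2 - ε) * β)
    (hα : 0 ≤ α) (hα1 : α ≤ 1) {x w d r w' : K} (hx : x ∈ zeros A B)
    (hw' : w' ∈ resolvent (precond γ U A) (w + α • d - γ • U r)) :
    ⟪V (w' - x), w' - x⟫
      + (⟪V (w + α • d - w' - γ • U (r - B x)), w + α • d - w' - γ • U (r - B x)⟫
        + ε ^ 2 * β * ‖B w - B x‖ ^ 2)
      ≤ (1 + α) * ⟪V (w - x), w - x⟫ + (2 * α * ⟪V d, d⟫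
        + (2 * β) ^ 2 * ‖U‖⁻¹ * ‖r - B w‖ ^ 2)
        - 2 * γ * ⟪w - x - γ • U (B w - B x) + α • d, r - B w⟫ := by
  have hγ0 : 0 < γ := hε.trans_le hγ
  set Δ := w + α • d - w' - γ • U (r - B x) with hΔ
  -- `g` is the step with the exact value `B w` in place of `r`, relative to `x`. It does not
  -- involve `r`, so its pairing with the noise will have zero conditional mean.
  set g := w - x - γ • U (B w - B x) + α • d with hg
  have e1 : (w + α • d - γ • U r - w') - (x - γ • U (B x) - x) = Δ := by
    simp only [hΔ, map_sub, smul_sub]; abel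
  have h1 := h.inner_sub_nonneg hA hγ0.le hw' (mem_resolvent_of_mem_zeros hx γ U)
  rw [e1] at h1
  have e2 : Δ + (w' - x) = g - γ • U (r - B w) := by
    simp only [hΔ, hg, map_sub, smul_sub]; abel
  have h2 := h.inner_add_add Δ (w' - x)
  rw [e2, h.inner_sub_smul] at h2
  have h3 := h.inner_add_smul_le (a := w - x - γ • U (B w - B x)) (b := d) hα hα1
  rw [← hg] at h3
  have h4 := h.inner_forward_le hβ hε hγ hγU (hB w x)
  have h5 : γ ^ 2 * ⟪U (r - B w), r - B w⟫ ≤ (2 * β) ^ 2 * ‖U‖⁻¹ * ‖r - B w‖ ^ 2 := by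
    have h6 : ⟪U (r - B w), r - B w⟫ ≤ ‖U‖ * ‖r - B w‖ ^ 2 := by
      refine (real_inner_le_norm _ _).trans ?_
      rw [pow_two, ← mul_assoc]
      exact mul_le_mul_of_nonneg_right (U.le_opNorm _) (norm_nonneg _)
    -- A bound free of `γ`, hence uniform in `n`; for `‖U‖ = 0` both sides vanish.
    have h7 : γ ^ 2 * ‖U‖ ≤ (2 * β) ^ 2 * ‖U‖⁻¹ := by
      rcases (norm_nonneg U).eq_or_lt with h0 | h0
      · simp [← h0]
      · rw [← div_eq_mul_inv, le_div_iff₀ h0]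
        have h8 : γ * ‖U‖ ≤ 2 * β := by nlinarith
        calc γ ^ 2 * ‖U‖ * ‖U‖ = (γ * ‖U‖) ^ 2 := by ring
          _ ≤ _ := pow_le_pow_left₀ (by positivity) h8 2
    calc _ ≤ γ ^ 2 * (‖U‖ * ‖r - B w‖ ^ 2) := by gcongr
      _ = γ ^ 2 * ‖U‖ * ‖r - B w‖ ^ 2 := by ring
      _ ≤ _ := by gcongr
  have h9 : (1 + α) * ⟪V (w - x - γ • U (B w - B x)), w - x - γ • U (B w - B x)⟫
      ≤ (1 + α) * ⟪V (w - x), w - x⟫ - ε ^ 2 * β * ‖B w - B x‖ ^ 2 := by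
    have h10 := mul_le_mul_of_nonneg_left h4 (by linarith : 0 ≤ 1 + α)
    have h11 : 0 ≤ α * (ε ^ 2 * β * ‖B w - B x‖ ^ 2) := by positivity
    linarith
  linarith

end Monotone

end OperatorFacts

/-- A function that depends on a strongly measurable one in a Lipschitz way is strongly
measurable. -/
lemma stronglyMeasurable_of_norm_sub_le {Ω K : Type*} {m0 : MeasurableSpace Ω}
    [NormedAddCommGroup K] [MeasurableSpace K] [BorelSpace K] {y w : Ω → K} {L : ℝ}
    (hy : StronglyMeasurable y) (h : ∀ ω ω', ‖w ω - w ω'‖ ≤ L * ‖y ω - y ω'‖) :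
    StronglyMeasurable w := by
  have h0 : ∀ ω ω', y ω = y ω' → w ω = w ω' := fun ω ω' e => by
    have := h ω ω'
    rw [e, sub_self, norm_zero, mul_zero] at this
    exact sub_eq_zero.1 (norm_le_zero_iff.1 this)
  let f : Set.range y → K := fun z => w z.2.choose
  have hf : ∀ ω, f ⟨y ω, ω, rfl⟩ = w ω := fun ω =>
    h0 _ _ (Set.mem_range_self (f := y) ω).choose_spec
  have hfl : LipschitzWith (Real.toNNReal L) f := by
    refine LipschitzWith.of_dist_le_mul ?_
    rintro ⟨_, ω, rfl⟩ ⟨_, ω', rfl⟩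
    rw [hf, hf, Subtype.dist_eq, dist_eq_norm, dist_eq_norm]
    exact (h ω ω').trans (mul_le_mul_of_nonneg_right (Real.le_coe_toNNReal L) (norm_nonneg _))
  have e : w = f ∘ Set.rangeFactorization y := by
    funext ω
    exact (hf ω).symm
  refine stronglyMeasurable_iff_measurable_separable.2 ⟨?_, ?_⟩
  · rw [e]
    exact hfl.continuous.measurable.comp (hy.measurable.subtype_mk)
  · have hsep : TopologicalSpace.SeparableSpace (Set.range y) :=
      hy.isSeparable_range.separableSpace
    rw [e]
    exact (TopologicalSpace.isSeparable_range hfl.continuous).mono (Set.range_comp_subset_range _ _)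

/-! ### Pathwise weak convergence. -/

section Deterministic

variable {K : Type*} [NormedAddCommGroup K] [InnerProductSpace ℝ K]
  {A : K → Set K} {B : K → K} {U V : K →L[ℝ] K} {c β ε : ℝ}

lemma IsMetricInverse.tendsto_zero_of_inner (h : IsMetricInverse U V c) {v : ℕ → K}
    (hv : Tendsto (fun n => ⟪V (v n), v n⟫) atTop (𝓝 0)) : Tendsto v atTop (𝓝 0) := by
  have h1 : Tendsto (fun n => c⁻¹ * ⟪V (v n), v n⟫) atTop (𝓝 0) := by
    simpa using hv.const_mul c⁻¹
  have h2 : Tendsto (fun n => ‖v n‖ ^ 2) atTop (𝓝 0) := by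
    refine squeeze_zero (fun n => sq_nonneg _) (fun n => ?_) h1
    rw [inv_mul_eq_div, le_div_iff₀ h.pos, mul_comm]
    exact h.coercive _
  refine tendsto_zero_iff_norm_tendsto_zero.2 ?_
  have h3 := h2.sqrt
  simpa using h3

lemma IsMetricInverse.exists_norm_le (h : IsMetricInverse U V c) {v : ℕ → K} {x : K} {l : ℝ}
    (hv : Tendsto (fun n => ⟪V (v n - x), v n - x⟫) atTop (𝓝 l)) : ∃ M, ∀ n, ‖v n‖ ≤ M := by
  obtain ⟨M, hM⟩ := hv.bddAbove_range
  refine ⟨√(M / c) + ‖x‖, fun n => ?_⟩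
  have h1 : ‖v n - x‖ ≤ √(M / c) := by
    refine Real.le_sqrt_of_sq_le ?_
    rw [le_div_iff₀ h.pos, mul_comm]
    exact (h.coercive _).trans (hM ⟨n, rfl⟩)
  calc ‖v n‖ = ‖(v n - x) + x‖ := by rw [sub_add_cancel]
    _ ≤ _ := (norm_add_le _ _).trans (by gcongr)

/-- Weak convergence of a trajectory of the algorithm along which the errors vanish and the
distances to the points of `D` converge. -/
theorem IsMetricInverse.exists_weakTendsto_zeros [CompleteSpace K] (h : IsMetricInverse U V c)
    (hA : IsMaximallyMonotone A) (hβ : 0 < β) (hB : IsCocoercive β B) (hε : 0 < ε)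
    {γ α : ℕ → ℝ} (hγ : ∀ n, ε ≤ γ n) (hγU : ∀ n, γ n * ‖U‖ ≤ (2 - ε) * β)
    {w r d : ℕ → K} (hd : Tendsto (fun n => α n • d n) atTop (𝓝 0))
    (hw : ∀ n, w (n + 1) ∈ resolvent (precond (γ n) U A) (w n + α n • d n - γ n • U (r n)))
    (hr : Summable fun n => ‖r n - B (w n)‖ ^ 2) {x : K} {l : ℝ}
    (hxl : Tendsto (fun n => ⟪V (w n - x), w n - x⟫) atTop (𝓝 l))
    (hxs : Summable fun n =>
      ⟪V (w n + α n • d n - w (n + 1) - γ n • U (r n - B x)),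
        w n + α n • d n - w (n + 1) - γ n • U (r n - B x)⟫ + ε ^ 2 * β * ‖B (w n) - B x‖ ^ 2)
    {S : Submodule ℝ K} (hS : IsClosed (S : Set K)) (hwS : ∀ n, w n ∈ S) {D : Set K}
    (hDS : zeros A B ∩ S ⊆ closure D)
    (hD : ∀ y ∈ D, ∃ l, Tendsto (fun n => ⟪V (w n - y), w n - y⟫) atTop (𝓝 l)) :
    ∃ p, p ∈ zeros A B ∧ WeakTendsto w atTop p ∧ Tendsto (fun n => B (w n)) atTop (𝓝 (B p)) ∧
      ∃ M, ∀ n, ‖w n‖ ≤ M := by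
  obtain ⟨M, hM⟩ := h.exists_norm_le hxl
  set Δ : ℕ → K := fun n => w n + α n • d n - w (n + 1) - γ n • U (r n - B x) with hΔ
  have hb0 : ∀ n, 0 ≤ ε ^ 2 * β * ‖B (w n) - B x‖ ^ 2 := fun n => by positivity
  have hT := hxs.tendsto_atTop_zero
  have hΔ0 : Tendsto Δ atTop (𝓝 0) := h.tendsto_zero_of_inner
    (squeeze_zero (fun n => h.inner_self_nonneg _) (fun n => le_add_of_nonneg_right (hb0 n)) hT)
  have hBw : Tendsto (fun n => B (w n)) atTop (𝓝 (B x)) := by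
    have h1 := squeeze_zero hb0
      (fun n => le_add_of_nonneg_left (h.inner_self_nonneg (Δ n))) hT
    have h3 : ε ^ 2 * β ≠ 0 := by positivity
    have h2 : Tendsto (fun n => ‖B (w n) - B x‖ ^ 2) atTop (𝓝 0) := by
      have := h1.const_mul (ε ^ 2 * β)⁻¹
      rw [mul_zero] at this
      exact this.congr fun n => inv_mul_cancel_left₀ h3 _
    refine tendsto_iff_norm_sub_tendsto_zero.2 ?_
    simpa using h2.sqrt
  have hrx : Tendsto (fun n => r n - B x) atTop (𝓝 0) := by
    have h1 : Tendsto (fun n => r n - B (w n)) atTop (𝓝 0) := by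
      refine tendsto_zero_iff_norm_tendsto_zero.2 ?_
      simpa using hr.tendsto_atTop_zero.sqrt
    have h2 := h1.add (hBw.sub_const (B x))
    simpa using h2
  have hUr : Tendsto (fun n => γ n • U (r n - B x)) atTop (𝓝 0) := by
    have h1 : Tendsto (fun n => (2 - ε) * β * ‖r n - B x‖) atTop (𝓝 0) := by
      simpa using (tendsto_zero_iff_norm_tendsto_zero.1 hrx).const_mul ((2 - ε) * β)
    refine squeeze_zero_norm (fun n => ?_) h1
    have hγ0 : 0 ≤ γ n := hε.le.trans (hγ n)
    rw [norm_smul, Real.norm_of_nonneg hγ0]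
    calc γ n * ‖U (r n - B x)‖ ≤ γ n * (‖U‖ * ‖r n - B x‖) := by
          gcongr; exact U.le_opNorm _
      _ = γ n * ‖U‖ * ‖r n - B x‖ := by ring
      _ ≤ _ := mul_le_mul_of_nonneg_right (hγU n) (norm_nonneg _)
  have hdiff : Tendsto (fun n => w n - w (n + 1)) atTop (𝓝 0) := by
    have h1 := (hΔ0.add hUr).sub hd
    rw [add_zero, sub_zero] at h1
    refine h1.congr fun n => ?_
    simp only [hΔ]
    abel
  choose a haA ha using fun n => mem_resolvent_precond_iff.1 (hw n)
  have hax : Tendsto a atTop (𝓝 (-B x)) := by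
    have h1 : Tendsto (fun n => ε⁻¹ * (‖V‖ * ‖Δ n‖)) atTop (𝓝 0) := by
      simpa using ((tendsto_zero_iff_norm_tendsto_zero.1 hΔ0).const_mul ‖V‖).const_mul ε⁻¹
    refine tendsto_iff_norm_sub_tendsto_zero.2 (squeeze_zero (fun n => norm_nonneg _)
      (fun n => ?_) h1)
    -- Applying `V` removes `U`, and `γ n ≥ ε` turns `Δ n → 0` into `a n → -B x`.
    have e1 : Δ n = γ n • U (a n + B x) := by
      have e2 : Δ n = (w n + α n • d n - γ n • U (r n)) - w (n + 1) + γ n • U (B x) := by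
        simp only [hΔ, map_sub, smul_sub]; abel
      rw [e2, ha n, map_add, smul_add]
      abel
    have e3 : V (Δ n) = γ n • (a n + B x) := by rw [e1, map_smul, h.left_inv]
    have h2 : ε * ‖a n + B x‖ ≤ ‖V‖ * ‖Δ n‖ := by
      refine le_trans ?_ (V.le_opNorm (Δ n))
      rw [e3, norm_smul, Real.norm_of_nonneg (hε.le.trans (hγ n))]
      gcongr
      exact hγ n
    rw [sub_neg_eq_add, inv_mul_eq_div, le_div_iff₀ hε, mul_comm]
    exact h2
  have hclus : ∀ (f : Ultrafilter ℕ) (p : K), (f : Filter ℕ) ≤ atTop → WeakTendsto w f p →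
      p ∈ zeros A B ∧ B x = B p := fun f p hf hp => by
    -- `a n` belongs to `A` at `w (n + 1)`, not at `w n`, so the cluster point must be carried
    -- across the shift.
    have h1 : WeakTendsto (fun n => w (n + 1)) f p := by
      have := hp.sub (weakTendsto_of_tendsto (hdiff.mono_left hf))
      simpa using this
    have h2 := hA.mem_of_weakTendsto haA h1 (fun n => hM (n + 1)) (hax.mono_left hf)
    have h3 := hB.eq_of_weakTendsto hβ hp hM (hBw.mono_left hf)
    exact ⟨⟨_, h2, by rw [h3, neg_add_cancel]⟩, h3⟩
  obtain ⟨p, hp⟩ := exists_weakTendsto_of_opial h.symm (fun y hy => by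
      have h1 := h.coercive y
      rw [hy] at h1
      have h2 : ‖y‖ ^ 2 ≤ 0 := by
        by_contra hc
        exact absurd h1 (not_le.2 (mul_pos h.pos (not_le.1 hc)))
      exact norm_eq_zero.1 (pow_eq_zero_iff two_ne_zero |>.1 (le_antisymm h2 (sq_nonneg _))))
    hM hD (fun f p hf hp => hDS ⟨(hclus f p hf hp).1, hp.mem_of_forall_mem hS hwS⟩)
  have h1 := hclus (Ultrafilter.of atTop) p (Ultrafilter.of_le _) (hp.mono (Ultrafilter.of_le _))
  exact ⟨p, h1.1, hp, h1.2 ▸ hBw, M, hM⟩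

end Deterministic

/-! ### Measurability of the iterates and the stochastic estimate. -/

section Iterates

variable {K : Type*} [NormedAddCommGroup K] [InnerProductSpace ℝ K]
  {Ω : Type*} {m0 : MeasurableSpace Ω} {μ : Measure Ω}

lemma integrable_inner_of_memLp_two {f g : Ω → K} (hf : MemLp f 2 μ) (hg : MemLp g 2 μ) :
    Integrable (fun ω => ⟪f ω, g ω⟫) μ := by
  have hf2 := hf.integrable_norm_pow (p := 2) two_ne_zero
  have hg2 := hg.integrable_norm_pow (p := 2) two_ne_zero
  refine (hf2.add hg2).mono' (hf.1.inner hg.1) (Eventually.of_forall fun ω => ?_)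
  refine (norm_inner_le_norm _ _).trans ?_
  simp only [Pi.add_apply]
  nlinarith [sq_nonneg (‖f ω‖ - ‖g ω‖), sq_nonneg ‖f ω‖, sq_nonneg ‖g ω‖]

/-- The natural filtration `σ(w 0, …, w n)`. -/
def historyFiltration [MeasurableSpace K] (w : ℕ → Ω → K) (hw : ∀ n, Measurable (w n)) :
    Filtration ℕ m0 where
  seq := history w
  mono' _ _ hij := iSup₂_le fun k hk =>
    le_iSup₂_of_le (f := fun k _ => MeasurableSpace.comap (w k) inferInstance) k
      (hk.trans hij) le_rfl
  le' _ := iSup₂_le fun k _ => (hw k).comap_le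

omit [InnerProductSpace ℝ K] in
-- Separability of the range does not depend on the σ-algebra, so only measurability has to be
-- checked in `history w n`.
lemma stronglyMeasurable_history [MeasurableSpace K] [BorelSpace K] {w : ℕ → Ω → K}
    (hw : ∀ n, StronglyMeasurable (w n)) {i n : ℕ} (hin : i ≤ n) :
    StronglyMeasurable[history w n] (w i) := by
  refine stronglyMeasurable_iff_measurable_separable.2 ⟨?_, (hw i).isSeparable_range⟩
  rw [measurable_iff_comap_le]
  exact le_iSup₂_of_le (f := fun k _ => MeasurableSpace.comap (w k) inferInstance) i hin le_rfl

variable [MeasurableSpace K] [BorelSpace K] {A : K → Set K} {B : K → K} {U V : K →L[ℝ] K}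
  {c β ε : ℝ} {γ α : ℕ → ℝ} {r w : ℕ → Ω → K}

/-- The iterates are strongly measurable and square integrable. -/
lemma IsMetricInverse.stronglyMeasurable_memLp [IsFiniteMeasure μ] (h : IsMetricInverse U V c)
    (hA : IsMonotoneOp A) (hP : (zeros A B).Nonempty) (hγ : ∀ n, 0 ≤ γ n)
    (hrmeas : ∀ n, StronglyMeasurable (r n)) (hrL2 : ∀ n, MemLp (r n) 2 μ)
    (hw0meas : StronglyMeasurable (w 0)) (hw0L2 : MemLp (w 0) 2 μ)
    (hw : ∀ n ω, w (n + 1) ω ∈ resolvent (precond (γ n) U A)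
      (extrapolate α w n ω - γ n • U (r n ω))) (n : ℕ) :
    StronglyMeasurable (w n) ∧ MemLp (w n) 2 μ := by
  induction n using Nat.strong_induction_on with
  | _ n ih =>
    rcases n with _ | n
    · exact ⟨hw0meas, hw0L2⟩
    obtain ⟨h1, h2⟩ := ih n (Nat.lt_succ_self n)
    obtain ⟨h3, h4⟩ := ih (n - 1) (by omega)
    obtain ⟨x, hx⟩ := hP
    have hym : StronglyMeasurable (fun ω => extrapolate α w n ω - γ n • U (r n ω)) :=
      (h1.add ((h1.sub h3).const_smul (α n))).sub
        ((U.continuous.comp_stronglyMeasurable (hrmeas n)).const_smul (γ n))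
    have hyL : MemLp (fun ω => extrapolate α w n ω - γ n • U (r n ω)) 2 μ :=
      (h2.add ((h2.sub h4).const_smul (α n))).sub ((U.comp_memLp' (hrL2 n)).const_smul (γ n))
    have hwm : StronglyMeasurable (w (n + 1)) := stronglyMeasurable_of_norm_sub_le hym
      fun ω ω' => h.norm_resolvent_sub_le hA (hγ n) (hw n ω) (hw n ω')
    refine ⟨hwm, ?_⟩
    -- A zero `x` is the resolvent of the constant `x - γ n • U (B x)`, so the Lipschitz bound
    -- controls the distance to `x`.
    have h5 : MemLp (fun ω => w (n + 1) ω - x) 2 μ := by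
      refine (hyL.sub (memLp_const (x - γ n • U (B x)))).of_le_mul
        (c := ‖V‖ / c) (hwm.sub stronglyMeasurable_const).aestronglyMeasurable
        (Eventually.of_forall fun ω => ?_)
      exact h.norm_resolvent_sub_le hA (hγ n) (hw n ω) (mem_resolvent_of_mem_zeros hx (γ n) U)
    have h6 := h5.add (memLp_const x)
    refine h6.congr_norm hwm.aestronglyMeasurable (Eventually.of_forall fun ω => ?_)
    simp

/-- Almost sure convergence of the distances to a solution, and summability of the residuals. -/
theorem IsMetricInverse.ae_tendsto_and_summable [CompleteSpace K] [IsFiniteMeasure μ]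
    (h : IsMetricInverse U V c)
    (hA : IsMonotoneOp A) (hβ : 0 < β) (hB : IsCocoercive β B) (hε : 0 < ε)
    (hγ : ∀ n, ε ≤ γ n) (hγU : ∀ n, γ n * ‖U‖ ≤ (2 - ε) * β)
    (hα0 : ∀ n, 0 ≤ α n) (hα1 : ∀ n, α n ≤ 1)
    (hrL2 : ∀ n, MemLp (r n) 2 μ)
    (hwm : ∀ n, StronglyMeasurable (w n)) (hwL2 : ∀ n, MemLp (w n) 2 μ)
    (hw : ∀ n ω, w (n + 1) ω ∈ resolvent (precond (γ n) U A)
      (extrapolate α w n ω - γ n • U (r n ω)))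
    (hunbiased : ∀ n, μ[r n | history w n] =ᵐ[μ] fun ω => B (w n ω))
    (hvar : ∀ᵐ ω ∂μ, Summable fun n =>
      (μ[fun ω' => ‖r n ω' - B (w n ω')‖ ^ 2 | history w n]) ω)
    (hincr : ∀ᵐ ω ∂μ, BddAbove (Set.range fun n => ‖w n ω - w (n - 1) ω‖))
    (hαsum : Summable α) {x : K} (hx : x ∈ zeros A B) :
    ∀ᵐ ω ∂μ, (∃ l, Tendsto (fun n => ⟪V (w n ω - x), w n ω - x⟫) atTop (𝓝 l)) ∧
      Summable fun n =>
        ⟪V (w n ω + α n • (w n ω - w (n - 1) ω) - w (n + 1) ω - γ n • U (r n ω - B x)),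
          w n ω + α n • (w n ω - w (n - 1) ω) - w (n + 1) ω - γ n • U (r n ω - B x)⟫
          + ε ^ 2 * β * ‖B (w n ω) - B x‖ ^ 2 := by
  set ℱ : Filtration ℕ m0 := historyFiltration w fun n => (hwm n).measurable with hℱ
  have hBc := hB.continuous hβ
  have hwF : ∀ {i n}, i ≤ n → StronglyMeasurable[ℱ n] (w i) := stronglyMeasurable_history hwm
  have hxL : ∀ y : K, MemLp (fun _ : Ω => y) 2 μ := fun y => memLp_const y
  have hbL : ∀ n, MemLp (fun ω => B (w n ω) - B x) 2 μ := fun n =>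
    ((hwL2 n).sub (hxL x)).of_le_mul ((hBc.comp_stronglyMeasurable (hwm n)).sub
      stronglyMeasurable_const).aestronglyMeasurable
      (Eventually.of_forall fun ω => hB.norm_map_sub_le hβ _ _)
  have hξL : ∀ n, MemLp (fun ω => r n ω - B (w n ω)) 2 μ := fun n => by
    convert ((hrL2 n).sub (hxL (B x))).sub (hbL n) using 1
    funext ω
    simp
  have hBL : ∀ n, MemLp (fun ω => B (w n ω)) 2 μ := fun n => by
    convert (hbL n).add (hxL (B x)) using 1
    funext ω
    simp
  have hdL : ∀ n, MemLp (fun ω => w n ω - w (n - 1) ω) 2 μ := fun n => (hwL2 n).sub (hwL2 _)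
  have hwxL : ∀ n, MemLp (fun ω => w n ω - x) 2 μ := fun n => (hwL2 n).sub (hxL x)
  have hqi : ∀ {f : Ω → K}, MemLp f 2 μ → Integrable (fun ω => ⟪V (f ω), f ω⟫) μ := fun hf =>
    integrable_inner_of_memLp_two (V.comp_memLp' hf) hf
  set g : ℕ → Ω → K := fun n ω =>
    w n ω - x - γ n • U (B (w n ω) - B x) + α n • (w n ω - w (n - 1) ω) with hg
  have hgL : ∀ n, MemLp (g n) 2 μ := fun n =>
    ((hwxL n).sub ((U.comp_memLp' (hbL n)).const_smul (γ n))).add ((hdL n).const_smul (α n))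
  have hgm : ∀ n, StronglyMeasurable[ℱ n] (g n) := fun n =>
    (((hwF le_rfl).sub stronglyMeasurable_const).sub
      ((U.continuous.comp_stronglyMeasurable ((hBc.comp_stronglyMeasurable (hwF le_rfl)).sub
        stronglyMeasurable_const)).const_smul (γ n))).add
      (((hwF le_rfl).sub (hwF (Nat.sub_le n 1))).const_smul (α n))
  set X : ℕ → Ω → ℝ := fun n ω => ⟪V (w n ω - x), w n ω - x⟫ with hXdef
  set T : ℕ → Ω → ℝ := fun n ω =>
        ⟪V (w n ω + α n • (w n ω - w (n - 1) ω) - w (n + 1) ω - γ n • U (r n ω - B x)),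
          w n ω + α n • (w n ω - w (n - 1) ω) - w (n + 1) ω - γ n • U (r n ω - B x)⟫
          + ε ^ 2 * β * ‖B (w n ω) - B x‖ ^ 2 with hTdef
  set Q : ℕ → Ω → ℝ := fun n ω =>
    2 * α n * ⟪V (w n ω - w (n - 1) ω), w n ω - w (n - 1) ω⟫ with hQdef
  set N : ℕ → Ω → ℝ := fun n ω => ‖r n ω - B (w n ω)‖ ^ 2 with hNdef
  set C : ℝ := (2 * β) ^ 2 * ‖U‖⁻¹ with hC
  have hC0 : 0 ≤ C := by positivity
  set I : ℕ → Ω → ℝ := fun n ω => ⟪g n ω, r n ω - B (w n ω)⟫ with hIdef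
  have hXi : ∀ n, Integrable (X n) μ := fun n => hqi (hwxL n)
  have hTi : ∀ n, Integrable (T n) μ := fun n =>
    (hqi ((((hwL2 n).add ((hdL n).const_smul (α n))).sub (hwL2 (n + 1))).sub
      ((U.comp_memLp' ((hrL2 n).sub (hxL (B x)))).const_smul (γ n)))).add
      (((hbL n).integrable_norm_pow (p := 2) two_ne_zero).const_mul _)
  have hQi : ∀ n, Integrable (Q n) μ := fun n => (hqi (hdL n)).const_mul _
  have hNi : ∀ n, Integrable (N n) μ := fun n =>
    (hξL n).integrable_norm_pow (p := 2) two_ne_zero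
  have hIi : ∀ n, Integrable (I n) μ := fun n => integrable_inner_of_memLp_two (hgL n) (hξL n)
  have hQm : ∀ n, StronglyMeasurable[ℱ n] (Q n) := fun n => by
    have : StronglyMeasurable[ℱ n] fun ω => w n ω - w (n - 1) ω :=
      (hwF le_rfl).sub (hwF (Nat.sub_le n 1))
    exact ((V.continuous.comp_stronglyMeasurable this).inner this).const_mul _
  have hXm : StronglyAdapted ℱ X := fun n => by
    have : StronglyMeasurable[ℱ n] fun ω => w n ω - x :=
      (hwF le_rfl).sub stronglyMeasurable_const
    exact (V.continuous.comp_stronglyMeasurable this).inner this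
  -- `g n` is known at time `n` and comes out of the conditional expectation; the noise is centred.
  have hI0 : ∀ n, μ[I n | ℱ n] =ᵐ[μ] 0 := fun n => by
    have h1 := condExp_bilin_of_stronglyMeasurable_left (μ := μ) (m := ℱ n) (innerSL ℝ (E := K))
      (hgm n) (hIi n) ((hξL n).integrable one_le_two)
    have h2 : μ[fun ω => r n ω - B (w n ω) | ℱ n] =ᵐ[μ] 0 := by
      have h3 := condExp_sub ((hrL2 n).integrable one_le_two)
        ((hBL n).integrable one_le_two) (ℱ n)
      rw [condExp_of_stronglyMeasurable (f := fun ω => B (w n ω)) (ℱ.le n)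
        (hBc.comp_stronglyMeasurable (hwF le_rfl)) ((hBL n).integrable one_le_two)] at h3
      refine h3.trans ?_
      filter_upwards [hunbiased n] with ω hω
      exact sub_eq_zero.2 hω
    refine h1.trans ?_
    filter_upwards [h2] with ω hω
    rw [hω]
    simp
  have hR : ∀ n, μ[Q n + C • N n | ℱ n] =ᵐ[μ] Q n + C • μ[N n | ℱ n] := fun n => by
    have h1 := condExp_add (hQi n) ((hNi n).smul C) (ℱ n)
    rw [condExp_of_stronglyMeasurable (ℱ.le n) (hQm n) (hQi n)] at h1
    exact h1.trans ((EventuallyEq.refl _ _).add (condExp_smul C (N n) (ℱ n)))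
  refine robbins_siegmund ℱ (R := fun n => Q n + C • N n) hα0 hαsum
    (fun n ω => h.inner_self_nonneg _)
    (fun n ω => add_nonneg (h.inner_self_nonneg _) (by positivity))
    (fun n ω => add_nonneg (mul_nonneg (mul_nonneg zero_le_two (hα0 n)) (h.inner_self_nonneg _))
      (mul_nonneg hC0 (sq_nonneg _))) hXm hXi hTi (fun n => ?_) ?_
  · have hpt : X (n + 1) + T n + (2 * γ n) • I n ≤ (1 + α n) • X n + (Q n + C • N n) :=
      fun ω => by
        have := h.step_le hA hβ hB hε (hγ n) (hγU n) (hα0 n) (hα1 n) hx (hw n ω)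
        simp only [hXdef, hTdef, hIdef, hQdef, hNdef, hg, Pi.add_apply, Pi.smul_apply,
          smul_eq_mul]
        linarith
    have hXT : Integrable (X (n + 1) + T n) μ := (hXi (n + 1)).add (hTi n)
    have hXs : Integrable ((1 + α n) • X n) μ := (hXi n).smul _
    have hRi : Integrable (Q n + C • N n) μ := (hQi n).add ((hNi n).smul C)
    have h1 := condExp_mono (m := ℱ n) (hXT.add ((hIi n).smul (2 * γ n))) (hXs.add hRi)
      (Eventually.of_forall hpt)
    have h2 := condExp_add hXT ((hIi n).smul (2 * γ n)) (ℱ n)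
    have h3 := condExp_add (hXi (n + 1)) (hTi n) (ℱ n)
    have h4 := condExp_smul (μ := μ) (2 * γ n) (I n) (ℱ n)
    have h5 := condExp_add hXs hRi (ℱ n)
    rw [condExp_of_stronglyMeasurable (ℱ.le n) ((hXm n).const_smul _) hXs] at h5
    filter_upwards [h1, h2, h3, h4, h5, hI0 n] with ω h1 h2 h3 h4 h5 h6
    rw [h2, h5, Pi.add_apply, h3, h4, Pi.smul_apply, h6] at h1
    simp only [Pi.zero_apply, smul_zero, add_zero] at h1
    exact h1
  · filter_upwards [ae_all_iff.2 hR, hvar, hincr] with ω h1 h2 ⟨M, hM⟩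
    simp_rw [h1]
    refine Summable.add ?_ (h2.mul_left C)
    refine Summable.of_nonneg_of_le
      (fun n => mul_nonneg (mul_nonneg zero_le_two (hα0 n)) (h.inner_self_nonneg _)) (fun n => ?_)
      -- `M` may depend on `ω`, since only a.s. summability of the perturbation is required.
      (hαsum.mul_left (2 * (‖V‖ * M ^ 2)))
    have hn : ‖w n ω - w (n - 1) ω‖ ≤ M := hM ⟨n, rfl⟩
    have h3 : ⟪V (w n ω - w (n - 1) ω), w n ω - w (n - 1) ω⟫ ≤ ‖V‖ * M ^ 2 := by
      refine (real_inner_le_norm _ _).trans ?_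
      calc _ ≤ ‖V‖ * ‖w n ω - w (n - 1) ω‖ * ‖w n ω - w (n - 1) ω‖ := by
            gcongr; exact V.le_opNorm _
        _ = ‖V‖ * ‖w n ω - w (n - 1) ω‖ ^ 2 := by ring
        _ ≤ _ := by gcongr
    have h4 := mul_le_mul_of_nonneg_left h3 (hα0 n)
    simp only [hQdef]
    linarith

end Iterates

end StochFB

/-! ### Assembly of the almost sure statements. -/

theorem theorem1
    {K : Type*} [NormedAddCommGroup K] [InnerProductSpace ℝ K] [CompleteSpace K]
    [MeasurableSpace K] [BorelSpace K]
    {Ω : Type*} [MeasurableSpace Ω] (μ : Measure Ω) [IsProbabilityMeasure μ]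
    -- the inclusion `0 ∈ A x + B x`
    (A : K → Set K) (hA : StochFB.IsMaximallyMonotone A)
    (B : K → K) (β : ℝ) (hβ : 0 < β) (hB : StochFB.IsCocoercive β B)
    (hP : (StochFB.zeros A B).Nonempty)
    -- the preconditioner
    (U : K →L[ℝ] K) (hUsa : IsSelfAdjoint U) (hUpos : StochFB.IsStronglyPositive U)
    -- `0 < ε < min {1, β / ‖U‖}`, `ε ≤ γ n ≤ (2 - ε) β / ‖U‖`, `0 ≤ α n ≤ 1 - ε`
    (ε : ℝ) (hε0 : 0 < ε) (hε1 : ε < 1) (hεU : ε * ‖U‖ < β)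
    (γ : ℕ → ℝ) (hγlow : ∀ n, ε ≤ γ n) (hγup : ∀ n, γ n * ‖U‖ ≤ (2 - ε) * β)
    (α : ℕ → ℝ) (hα : ∀ n, α n ∈ Set.Icc 0 (1 - ε))
    -- the square integrable random variables `r n` and `w 0`, and the iteration
    (r w : ℕ → Ω → K)
    (hrmeas : ∀ n, StronglyMeasurable (r n)) (hrL2 : ∀ n, MemLp (r n) 2 μ)
    (hw0meas : StronglyMeasurable (w 0)) (hw0L2 : MemLp (w 0) 2 μ)
    (hw : ∀ n ω, w (n + 1) ω ∈ StochFB.resolvent (StochFB.precond (γ n) U A)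
      (StochFB.extrapolate α w n ω - γ n • U (r n ω)))
    -- unbiasedness, summable conditional variances, bounded increments, summable inertia
    (hunbiased : ∀ n, μ[r n | StochFB.history w n] =ᵐ[μ] fun ω => B (w n ω))
    (hvar : ∀ᵐ ω ∂μ, Summable fun n =>
      (μ[fun ω' => ‖r n ω' - B (w n ω')‖ ^ 2 | StochFB.history w n]) ω)
    (hincr : ∀ᵐ ω ∂μ, BddAbove (Set.range fun n => ‖w n ω - w (n - 1) ω‖))
    (hαsum : Summable α) :
    ∃ wbar : Ω → K, StronglyMeasurable wbar ∧
      (∀ᵐ ω ∂μ, wbar ω ∈ StochFB.zeros A B) ∧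
      (∀ᵐ ω ∂μ, Tendsto (fun n => toWeakSpace ℝ K (w n ω)) atTop
        (𝓝 (toWeakSpace ℝ K (wbar ω)))) ∧
      (∀ᵐ ω ∂μ, Tendsto (fun n => B (w n ω)) atTop (𝓝 (B (wbar ω)))) ∧
      (∀ᵐ ω ∂μ, StochFB.IsUniformlyMonotoneAt B (wbar ω) →
        Tendsto (fun n => ‖w n ω - wbar ω‖) atTop (𝓝 0)) := by
  obtain ⟨V, c, h⟩ := StochFB.exists_isMetricInverse hUsa hUpos
  have hγ0 : ∀ n, 0 ≤ γ n := fun n => hε0.le.trans (hγlow n)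
  have hα0 : ∀ n, 0 ≤ α n := fun n => (hα n).1
  have hα1 : ∀ n, α n ≤ 1 := fun n => (hα n).2.trans (by linarith)
  have hwmL := h.stronglyMeasurable_memLp (μ := μ) hA.1 hP hγ0 hrmeas hrL2 hw0meas hw0L2 hw
  have hwm : ∀ n, StronglyMeasurable (w n) := fun n => (hwmL n).1
  have key : ∀ x ∈ StochFB.zeros A B, _ := fun x hx =>
    h.ae_tendsto_and_summable (μ := μ) hA.1 hβ hB hε0 hγlow hγup hα0 hα1 hrL2 hwm
      (fun n => (hwmL n).2) hw hunbiased hvar hincr hαsum (x := x) hx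
  have hsep : TopologicalSpace.IsSeparable (⋃ n, Set.range (w n)) :=
    TopologicalSpace.IsSeparable.iUnion fun n => (hwm n).isSeparable_range
  let S : Submodule ℝ K := (Submodule.span ℝ (⋃ n, Set.range (w n))).topologicalClosure
  have hS : IsClosed (S : Set K) := Submodule.isClosed_topologicalClosure _
  have hwS : ∀ n ω, w n ω ∈ S := fun n ω => Submodule.le_topologicalClosure _
    (Submodule.subset_span (Set.mem_iUnion.2 ⟨n, ω, rfl⟩))
  have hSsep : TopologicalSpace.IsSeparable (S : Set K) := (hsep.span (R := ℝ)).closure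
  obtain ⟨D, hDs, hDc, hD⟩ := (hSsep.mono
    (Set.inter_subset_right (s := StochFB.zeros A B))).exists_countable_dense_subset
  have hsum2 : ∀ᵐ ω ∂μ, Summable fun n => ‖r n ω - B (w n ω)‖ ^ 2 := by
    refine StochFB.ae_summable_of_ae_summable_condExp
      (StochFB.historyFiltration w fun n => (hwm n).measurable)
      (T := fun n ω => ‖r n ω - B (w n ω)‖ ^ 2) (fun n ω => sq_nonneg _) (fun n => ?_) hvar
    refine MemLp.integrable_norm_pow (p := 2) ?_ two_ne_zero
    refine (hrL2 n).sub ?_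
    obtain ⟨x, hx⟩ := hP
    have h1 : MemLp (fun ω => B (w n ω) - B x) 2 μ :=
      ((hwmL n).2.sub (memLp_const x)).of_le_mul
        (((hB.continuous hβ).comp_stronglyMeasurable (hwm n)).sub
          stronglyMeasurable_const).aestronglyMeasurable
        (Eventually.of_forall fun ω => hB.norm_map_sub_le hβ _ _)
    convert h1.add (memLp_const (B x)) using 1
    funext ω
    simp
  -- Countability of `D` gives one null set valid for all its points.
  have hD' : ∀ᵐ ω ∂μ, ∀ y ∈ D,
      ∃ l, Tendsto (fun n => ⟪V (w n ω - y), w n ω - y⟫) atTop (𝓝 l) :=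
    (ae_ball_iff hDc).2 fun y hy => (key y (hDs hy).1).mono fun ω hω => hω.1
  let Q : Ω → K → Prop := fun ω p => p ∈ StochFB.zeros A B ∧
    StochFB.WeakTendsto (fun n => w n ω) atTop p ∧
    Tendsto (fun n => B (w n ω)) atTop (𝓝 (B p)) ∧ ∃ M, ∀ n, ‖w n ω‖ ≤ M
  have main : ∀ᵐ ω ∂μ, ∃ p, Q ω p := by
    obtain ⟨x, hx⟩ := hP
    filter_upwards [hsum2, hD', hincr, key x hx] with ω h1 h2 ⟨M, hM⟩ ⟨⟨l, hl⟩, h4⟩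
    refine h.exists_weakTendsto_zeros hA hβ hB hε0 hγlow hγup ?_ (fun n => hw n ω) h1 hl h4
      hS (fun n => hwS n ω) hD h2
    have h5 : Tendsto (fun n => α n * M) atTop (𝓝 0) := by
      simpa using hαsum.tendsto_atTop_zero.mul_const M
    refine squeeze_zero_norm (fun n => ?_) h5
    rw [norm_smul, Real.norm_of_nonneg (hα0 n)]
    exact mul_le_mul_of_nonneg_left (hM ⟨n, rfl⟩) (hα0 n)
  -- A pointwise choice without measurability; being a.e. the weak limit of the `w n`, it is a.e.
  -- equal to a strongly measurable function, which serves as the limit.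
  let p : Ω → K := fun ω => Classical.epsilon (Q ω)
  have hp : ∀ᵐ ω ∂μ, Q ω (p ω) := main.mono fun ω hω => Classical.epsilon_spec hω
  have hpm : AEStronglyMeasurable p μ :=
    StochFB.aestronglyMeasurable_of_weakTendsto hwm (hp.mono fun ω hω => hω.2.1)
  have hQ : ∀ᵐ ω ∂μ, Q ω (hpm.mk p ω) := by
    filter_upwards [hp, hpm.ae_eq_mk] with ω h1 h2
    rwa [← h2]
  refine ⟨hpm.mk p, hpm.stronglyMeasurable_mk, hQ.mono fun ω hω => hω.1,
    hQ.mono fun ω hω => hω.2.1.toWeakSpace, hQ.mono fun ω hω => hω.2.2.1,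
    hQ.mono fun ω hω hu => ?_⟩
  obtain ⟨M, hM⟩ := hω.2.2.2
  exact hu.tendsto_norm hM hω.2.2.1
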